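/- Let $b>1$ be an integer, let $A\subset\{0,1,\dots,b-1\}$ contain at least one nonzero digit, and let $N=\#A$, $s_0=\log_b N$, $\gamma_j=\sum_{a\in A}a^j$ (with $0^0=1$). Call a positive integer admissible if all its base-$b$ digits lie in $A$. The series $\sum_{n\text{ admissible}} n^{-s}$ converges for $\operatorname{Re} s>s_0$, and its sum has a meromorphic continuation $K$ to $\mathbb{C}$. For $m\in\mathbb{N}=\{0,1,2,\dots\}$ and $k\in\mathbb{Z}$ put $s_{m,k}=s_0-m+k\frac{2\pi i}{\log b}$ and let $\lambda_{m,k}$ be the residue (possibly zero) of $K$ at $s_{m,k}$. With $(x)_n=x(x+1)\cdots(x+n-1)$, define the modified residues $\mu_{m,k}$ by $$\lambda_{m,k}=\frac{-(-s_{0,k})_{m+1}}{m!}\,\mu_{m,k},$$ except when $k=0$ and $N\in\{1,b\}$. In these cases the factor can vanish, and one sets instead: if $N=1$ and $A=\{f\}$, then $\mu_{m,0}=\bigl(-\tfrac{f}{b-1}\bigr)^m$; if $N=b$, then $(\mu_{m,0})_{m\ge0}$ is the solution with $\mu_{0,0}=1$ of the recurrence (1) below for $k=0$, $m\ge1$.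 Then for all $m\in\mathbb{N}$ and $k\in\mathbb{Z}$: (1) $\displaystyle (1-b^{-m})\,\mu_{m,k}=-N^{-1}\sum_{j=1}^m\binom{m}{j}b^{-j}\gamma_j\,\mu_{m-j,k}$; (2) $\mu_{0,0}\neq0$ and $\displaystyle \mu_{m,k}=\frac{\mu_{0,k}}{\mu_{0,0}}\,\mu_{m,0}$; (3) $K$ has a pole at $s_{m,k}$ if and only if it has a pole at $s_{m,0}$ and a pole at $s_{0,k}$. -/

import Mathlib

open Filter Topology

namespace RestrictedDirichlet

/-- A positive integer is admissible when all its digits in base `b` belong to `A`. -/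
def Admissible (b : ℕ) (A : Finset ℕ) (n : ℕ) : Prop :=
  0 < n ∧ ∀ d ∈ Nat.digits b n, d ∈ A

/-- The abscissa `s₀ = log_b N`, with `N` the number of admissible digits. -/
noncomputable def abscissa (b : ℕ) (A : Finset ℕ) : ℝ :=
  Real.logb (b : ℝ) (A.card : ℝ)

/-- The terms of the restricted Dirichlet series: `n ^ (-s)` for admissible `n`, and `0` for
the other natural numbers. -/
noncomputable def term (b : ℕ) (A : Finset ℕ) (s : ℂ) : ℕ → ℂ :=
  Set.indicator {n : ℕ | Admissible b A n} (fun n => (n : ℂ) ^ (-s))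

/-- `K` is a meromorphic function on `ℂ` which for `Re s > s₀` is the sum of the restricted
Dirichlet series. -/
def IsMeromorphicContinuation (b : ℕ) (A : Finset ℕ) (K : ℂ → ℂ) : Prop :=
  (∀ s : ℂ, MeromorphicAt K s) ∧
    ∀ s : ℂ, abscissa b A < s.re → HasSum (term b A s) (K s)

/-- The residue of `f` at `z₀`: the value for small radii of the normalized integral along a
circle with center `z₀`. -/
noncomputable def residue (f : ℂ → ℂ) (z₀ : ℂ) : ℂ :=
  limUnder (𝓝[>] (0 : ℝ))
    (fun r : ℝ => (2 * (Real.pi : ℂ) * Complex.I)⁻¹ * ∮ z in C(z₀, r), f z)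

/-- The function `f` has a pole at `z₀`. -/
def IsPole (f : ℂ → ℂ) (z₀ : ℂ) : Prop :=
  MeromorphicAt f z₀ ∧ meromorphicOrderAt f z₀ < 0

/-- The candidate pole `s_{m,k} = s₀ - m + k * 2πi / log b`. -/
noncomputable def candidatePole (b : ℕ) (A : Finset ℕ) (m : ℕ) (k : ℤ) : ℂ :=
  (abscissa b A : ℂ) - (m : ℂ) +
    (k : ℂ) * (2 * (Real.pi : ℂ) * Complex.I / (Real.log (b : ℝ) : ℂ))

/-- The power sum `γ_j` of the admissible digits (with `0 ^ 0 = 1`). -/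
noncomputable def powerSum (A : Finset ℕ) (j : ℕ) : ℂ :=
  ∑ a ∈ A, (a : ℂ) ^ j

/-- The sequence `c` with `c 0 = 1` and, for `m ≥ 1`,
`(1 - b ^ (-m)) c_m = - N⁻¹ ∑_{i < m} (m choose (m - i)) b ^ (-(m - i)) γ_{m - i} c_i`. -/
noncomputable def normalizedSolution (b : ℕ) (A : Finset ℕ) : ℕ → ℂ
  | 0 => 1
  | m + 1 =>
      (-((A.card : ℂ)⁻¹) *
        ∑ i : Fin (m + 1),
          ((m + 1).choose (m + 1 - (i : ℕ)) : ℂ) * ((b : ℂ) ^ (m + 1 - (i : ℕ)))⁻¹ *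
            powerSum A (m + 1 - (i : ℕ)) * normalizedSolution b A (i : ℕ)) /
        (1 - ((b : ℂ) ^ (m + 1))⁻¹)
  decreasing_by exact i.isLt

open Classical in
/-- The modified residues `μ_{m,k}`. In general they are determined from the residues
`λ_{m,k}` by `λ_{m,k} = - ((-s_{0,k})_{m+1} / m!) μ_{m,k}`, where `(x)_n = x (x+1) ⋯ (x+n-1)`.
When `k = 0` and `N = 1` or `N = b` this Pochhammer symbol can vanish, and `μ_{m,0}` is then
defined separately: if `N = 1`, with `f` the only admissible digit, `μ_{m,0}` is
`(-f / (b - 1)) ^ m`; if `N = b`, it is the solution of the recurrence starting at `1`. -/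
noncomputable def modifiedResidue (b : ℕ) (A : Finset ℕ) (K : ℂ → ℂ) (m : ℕ) (k : ℤ) : ℂ :=
  if k = 0 ∧ A.card = 1 then (-(∑ a ∈ A, (a : ℂ)) / ((b : ℂ) - 1)) ^ m
  else if k = 0 ∧ A.card = b then normalizedSolution b A m
  else
    residue K (candidatePole b A m k) /
      (-((ascPochhammer ℂ (m + 1)).eval (-(candidatePole b A 0 k))) / (m.factorial : ℂ))

end RestrictedDirichlet

namespace RestrictedDirichlet

/-! An admissible number with at least two digits is `b * m + a` with `m` admissible and `a ∈ A`.
Expanding `(1 + a / (b * m)) ^ (-s)` binomially and summing gives, for every `n`, a functional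
equation (`eulerFactor_mul_tsum_term`): `(1 - N b ^ (-s)) K(s)` equals an entire function plus `b ^
(-s)` times a combination of `K(s + 1), …, K(s + n)` and a remainder analytic for `Re s > s₀ - n -
1`. It continues `K` one unit strip at a time (`exists_meromorphic_halfPlane`).

At `s_{m,k}` the factor on the left is `1 - b ^ m`: a simple zero if `m = 0`, nonzero otherwise. So
`K` has at most simple poles there, and comparing residues gives a linear recurrence
(`residue_recurrence`). Dividing by the Pochhammer factor turns its coefficients into `m.choose j`,
independent of `k` (`binomCoeff_mul_residueFactor`). The modified residues thus solve the same
recurrence for all `k`, and a solution is determined by its first entry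
(`SatisfiesRecurrence.mul_eq_mul`), whence proportionality. That `μ_{0,0} ≠ 0` comes from `(1 - N b
^ (-σ)) K(σ) ≥ b ^ (-σ)` for real `σ > s₀` (`rpow_le_mul_tsum`).

Where the Pochhammer factor is nonzero, in particular for `k ≠ 0`, poles correspond to nonzero
modified residues. For `k = 0`, `N = 1` the residues themselves satisfy the recurrence; for `N = b`,
`K` is the Riemann zeta function. -/

/-! ### Splitting off the last digit. -/

theorem admissible_mul_add {b : ℕ} (hb : 1 < b) {A : Finset ℕ} (m : ℕ) {d : ℕ} (hd : d < b) :
    Admissible b A (b * m + d) ↔ (m = 0 ∧ d ≠ 0 ∧ d ∈ A) ∨ (Admissible b A m ∧ d ∈ A) := by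
  unfold Admissible
  by_cases h : d ≠ 0 ∨ m ≠ 0
  · have hpos : 0 < b * m + d := by
      rcases h with h | h
      · omega
      · have := Nat.mul_pos (by omega : 0 < b) (Nat.pos_of_ne_zero h)
        omega
    rw [add_comm, Nat.digits_add b hb d m hd h]
    rcases Nat.eq_zero_or_pos m with rfl | hm
    · simp at h ⊢
      omega
    · simp [hm, hm.ne', and_comm]
      omega
  · push Not at h
    obtain ⟨rfl, rfl⟩ := h
    simp

/-- The extra term is the block `m = 0`: since `0` is not admissible, the one-digit numbers arise
from no admissible `m`. -/
theorem sum_range_indicator_admissible {b : ℕ} (hb : 1 < b) {A : Finset ℕ}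
    (hA : ∀ a ∈ A, a < b) {E : Type*} [AddCommMonoid E] (f : ℕ → E) (m : ℕ) :
    ∑ d ∈ Finset.range b, Set.indicator {n | Admissible b A n} f (b * m + d) =
      Set.indicator {n | Admissible b A n} (fun m => ∑ a ∈ A, f (b * m + a)) m +
        if m = 0 then ∑ a ∈ A.erase 0, f a else 0 := by
  classical
  have hAr : A ⊆ Finset.range b := fun a ha => Finset.mem_range.2 (hA a ha)
  rcases Nat.eq_zero_or_pos m with rfl | hm
  · have h0 : ¬ Admissible b A 0 := fun h => h.1.ne rfl
    rw [Set.indicator_of_notMem (by exact h0), if_pos rfl, zero_add]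
    symm
    refine Finset.sum_subset_zero_on_sdiff ((Finset.erase_subset _ _).trans hAr) ?_ ?_
    · intro d hd
      rw [Finset.mem_sdiff, Finset.mem_range, Finset.mem_erase] at hd
      refine Set.indicator_of_notMem ?_ _
      rw [Set.mem_ofPred_eq, admissible_mul_add hb 0 hd.1]
      tauto
    · intro d hd
      rw [Finset.mem_erase] at hd
      rw [Set.indicator_of_mem]
      · simp
      · rw [Set.mem_ofPred_eq, admissible_mul_add hb 0 (hA d hd.2)]
        tauto
  · rw [if_neg hm.ne', add_zero]
    by_cases hadm : Admissible b A m
    · rw [Set.indicator_of_mem (by exact hadm)]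
      symm
      refine Finset.sum_subset_zero_on_sdiff hAr ?_ ?_
      · intro d hd
        rw [Finset.mem_sdiff, Finset.mem_range] at hd
        refine Set.indicator_of_notMem ?_ _
        rw [Set.mem_ofPred_eq, admissible_mul_add hb m hd.1]
        tauto
      · intro d hd
        rw [Set.indicator_of_mem]
        rw [Set.mem_ofPred_eq, admissible_mul_add hb m (hA d hd)]
        tauto
    · rw [Set.indicator_of_notMem (by exact hadm)]
      refine Finset.sum_eq_zero fun d hd => Set.indicator_of_notMem ?_ _
      rw [Set.mem_ofPred_eq, admissible_mul_add hb m (Finset.mem_range.1 hd)]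
      have := hm.ne'
      tauto

theorem hasSum_indicator_admissible {b : ℕ} (hb : 1 < b) {A : Finset ℕ}
    (hA : ∀ a ∈ A, a < b) {E : Type*} [NormedAddCommGroup E] {f : ℕ → E} {z : E}
    (h : HasSum (Set.indicator {n | Admissible b A n} f) z) :
    HasSum (Set.indicator {n | Admissible b A n} (fun m => ∑ a ∈ A, f (b * m + a)))
      (z - ∑ a ∈ A.erase 0, f a) := by
  have : NeZero b := ⟨by omega⟩
  have h1 := (Nat.divModEquiv b).symm.hasSum_iff.2 h
  have h2 := h1.prod_fiberwise (fun m => hasSum_fintype _)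
  have h3 : HasSum (fun m : ℕ => if m = 0 then ∑ a ∈ A.erase 0, f a else 0)
      (∑ a ∈ A.erase 0, f a) := hasSum_ite_eq 0 _
  refine (h2.sub h3).congr_fun ?_
  intro m
  have h4 := sum_range_indicator_admissible hb hA f m
  rw [Finset.sum_range] at h4
  rw [eq_comm, sub_eq_iff_eq_add, ← h4]
  refine Finset.sum_congr rfl fun d _ => ?_
  simp [Nat.divModEquiv, mul_comm]

/-- The two sides differ only for `X = 0`, when the block of one-digit numbers is missing on the
left. -/
theorem sum_range_mul_indicator_admissible {b : ℕ} (hb : 1 < b) {A : Finset ℕ}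
    (hA : ∀ a ∈ A, a < b) {f : ℕ → ℝ} (hf : ∀ a ∈ A.erase 0, 0 ≤ f a) (X : ℕ) :
    ∑ n ∈ Finset.range (b * X), Set.indicator {n | Admissible b A n} f n ≤
      ∑ m ∈ Finset.range X,
        Set.indicator {n | Admissible b A n} (fun m => ∑ a ∈ A, f (b * m + a)) m +
      ∑ a ∈ A.erase 0, f a := by
  have key : ∀ X, ∑ n ∈ Finset.range (b * X), Set.indicator {n | Admissible b A n} f n =
      ∑ m ∈ Finset.range X,
        (Set.indicator {n | Admissible b A n} (fun m => ∑ a ∈ A, f (b * m + a)) m +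
        if m = 0 then ∑ a ∈ A.erase 0, f a else 0) := by
    intro X
    induction X with
    | zero => simp
    | succ X ih =>
      rw [Nat.mul_succ, Finset.sum_range_add, ih, Finset.sum_range_succ,
        sum_range_indicator_admissible hb hA]
  rw [key, Finset.sum_add_distrib]
  gcongr
  rw [Finset.sum_ite_eq']
  split_ifs
  · rfl
  · exact Finset.sum_nonneg hf

/-! ### Convergence to the right of the abscissa, and a lower bound near it. -/

theorem rpow_abscissa {b : ℕ} (hb : 1 < b) {A : Finset ℕ} (hN : 0 < A.card) :
    (b : ℝ) ^ abscissa b A = A.card := by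
  have hb' : (1 : ℝ) < b := by exact_mod_cast hb
  exact Real.rpow_logb (by linarith) hb'.ne' (by exact_mod_cast hN)

theorem abscissa_nonneg {b : ℕ} (hb : 1 < b) {A : Finset ℕ} (hN : 0 < A.card) :
    0 ≤ abscissa b A :=
  Real.logb_nonneg (by exact_mod_cast hb) (by exact_mod_cast hN)

theorem card_mul_rpow_neg_lt_one {b : ℕ} (hb : 1 < b) {A : Finset ℕ} (hN : 0 < A.card)
    {σ : ℝ} (hσ : abscissa b A < σ) : (A.card : ℝ) * (b : ℝ) ^ (-σ) < 1 := by
  have hb' : (1 : ℝ) < b := by exact_mod_cast hb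
  rw [← rpow_abscissa hb hN, ← Real.rpow_add (by linarith)]
  exact Real.rpow_lt_one_of_one_lt_of_neg hb' (by linarith)

/-- With `q = N b ^ (-σ) < 1`, the partial sums satisfy `S_X ≤ S_{bX} ≤ q S_X + D`, because `b * m +
a ≥ b * m`; hence they are bounded by `D / (1 - q)`. -/
theorem summable_rpow {b : ℕ} (hb : 1 < b) {A : Finset ℕ} (hA : ∀ a ∈ A, a < b)
    (hN : 0 < A.card) {σ : ℝ} (hσ : abscissa b A < σ) :
    Summable (Set.indicator {n | Admissible b A n} fun n : ℕ => (n : ℝ) ^ (-σ)) := by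
  have hσ0 : 0 < σ := (abscissa_nonneg hb hN).trans_lt hσ
  set q : ℝ := (A.card : ℝ) * (b : ℝ) ^ (-σ) with hq
  have hq1 : q < 1 := card_mul_rpow_neg_lt_one hb hN hσ
  set g := Set.indicator {n | Admissible b A n} fun n : ℕ => (n : ℝ) ^ (-σ) with hg
  have hg0 : ∀ n, 0 ≤ g n := fun n => Set.indicator_nonneg (fun n _ => by positivity) n
  set D : ℝ := ∑ a ∈ A.erase 0, (a : ℝ) ^ (-σ)
  refine summable_of_sum_range_le (c := D / (1 - q)) hg0 fun X => ?_
  rw [le_div_iff₀ (by linarith)]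
  have h1 : ∑ n ∈ Finset.range X, g n ≤ ∑ n ∈ Finset.range (b * X), g n :=
    Finset.sum_le_sum_of_subset_of_nonneg
      (Finset.range_mono (Nat.le_mul_of_pos_left X (by omega))) fun n _ _ => hg0 n
  have h2 := sum_range_mul_indicator_admissible hb hA (f := fun n : ℕ => (n : ℝ) ^ (-σ))
    (fun a _ => by positivity) X
  have h3 : ∑ m ∈ Finset.range X, Set.indicator {n | Admissible b A n}
      (fun m => ∑ a ∈ A, ((b * m + a : ℕ) : ℝ) ^ (-σ)) m ≤
      ∑ m ∈ Finset.range X, q * g m := by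
    refine Finset.sum_le_sum fun m _ => ?_
    by_cases hm : Admissible b A m
    · rw [hg, Set.indicator_of_mem (by exact hm), Set.indicator_of_mem (by exact hm), hq, mul_assoc,
        ← nsmul_eq_mul]
      refine Finset.sum_le_card_nsmul _ _ _ fun a _ => ?_
      have hm0 : (0 : ℝ) < m := by exact_mod_cast hm.1
      have hb0 : (0 : ℝ) < b := by exact_mod_cast (by omega : 0 < b)
      rw [← Real.mul_rpow hb0.le hm0.le]
      refine Real.rpow_le_rpow_of_nonpos (by positivity) ?_ (by linarith)
      push_cast
      linarith [(Nat.cast_nonneg a : (0 : ℝ) ≤ a)]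
    · rw [hg, Set.indicator_of_notMem (by exact hm), Set.indicator_of_notMem (by exact hm), mul_zero]
  rw [← Finset.mul_sum] at h3
  linarith

/-- This bound keeps the residue at `s₀` from vanishing. Replacing `n` by `n + 1` reverses the
comparison used for convergence: `b * m + a + 1 ≤ b * (m + 1)`. So the shifted sum `S` satisfies `S
≥ q S + D`, where `D ≥ b ^ (-σ)` thanks to a nonzero digit, and `S` is at most the original sum. -/
theorem rpow_le_mul_tsum {b : ℕ} (hb : 1 < b) {A : Finset ℕ} (hA : ∀ a ∈ A, a < b)
    (hA1 : ∃ a ∈ A, a ≠ 0) {σ : ℝ} (hσ : abscissa b A < σ) :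
    (b : ℝ) ^ (-σ) ≤ (1 - (A.card : ℝ) * (b : ℝ) ^ (-σ)) *
      ∑' n, Set.indicator {n | Admissible b A n} (fun n : ℕ => (n : ℝ) ^ (-σ)) n := by
  obtain ⟨a₀, ha₀, ha₀'⟩ := hA1
  have hN : 0 < A.card := Finset.card_pos.2 ⟨a₀, ha₀⟩
  have hσ0 : 0 < σ := (abscissa_nonneg hb hN).trans_lt hσ
  have hb0 : (0 : ℝ) < b := by exact_mod_cast (by omega : 0 < b)
  have hq1 := card_mul_rpow_neg_lt_one hb hN hσ
  set f : ℕ → ℝ := fun n => ((n : ℝ) + 1) ^ (-σ) with hf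
  have hsum := summable_rpow hb hA hN hσ
  have hle : ∀ n, Set.indicator {n | Admissible b A n} f n ≤
      Set.indicator {n | Admissible b A n} (fun n : ℕ => (n : ℝ) ^ (-σ)) n := by
    intro n
    by_cases hn : Admissible b A n
    · rw [Set.indicator_of_mem (by exact hn), Set.indicator_of_mem (by exact hn)]
      exact Real.rpow_le_rpow_of_nonpos (by exact_mod_cast hn.1) (by linarith) (by linarith)
    · rw [Set.indicator_of_notMem (by exact hn), Set.indicator_of_notMem (by exact hn)]
  have hfs : Summable (Set.indicator {n | Admissible b A n} f) :=
    hsum.of_nonneg_of_le (fun n => Set.indicator_nonneg (fun n _ => by positivity) n) hle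
  have h1 := hasSum_indicator_admissible hb hA hfs.hasSum
  have h2 := hfs.hasSum.mul_left ((A.card : ℝ) * (b : ℝ) ^ (-σ))
  have h3 := hasSum_le (fun m => ?_) h2 h1
  · have h4 : (b : ℝ) ^ (-σ) ≤ ∑ a ∈ A.erase 0, f a := by
      refine le_trans ?_ (Finset.single_le_sum (f := f) (fun a _ => by positivity)
        (Finset.mem_erase.2 ⟨ha₀', ha₀⟩))
      refine Real.rpow_le_rpow_of_nonpos (by positivity) ?_ (by linarith)
      exact_mod_cast hA a₀ ha₀
    have h5 := hfs.tsum_le_tsum hle hsum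
    have h6 := mul_le_mul_of_nonneg_left h5 (sub_nonneg.2 hq1.le)
    linarith
  · by_cases hm : Admissible b A m
    · rw [Set.indicator_of_mem (by exact hm), Set.indicator_of_mem (by exact hm), mul_assoc,
        ← nsmul_eq_mul]
      refine Finset.card_nsmul_le_sum _ _ _ fun a ha => ?_
      rw [hf, ← Real.mul_rpow hb0.le (by positivity)]
      refine Real.rpow_le_rpow_of_nonpos (by positivity) ?_ (by linarith)
      have : ((a + 1 : ℕ) : ℝ) ≤ b := by exact_mod_cast hA a ha
      push_cast at this ⊢
      linarith
    · rw [Set.indicator_of_notMem (by exact hm), Set.indicator_of_notMem (by exact hm), mul_zero]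

/-! ### The binomial series and its remainder. -/

/-- The `j`-th coefficient of the binomial series of `(1 + x) ^ (-s)`. -/
noncomputable def binomCoeff (s : ℂ) (j : ℕ) : ℂ :=
  (-1) ^ j * (ascPochhammer ℂ j).eval s / (j.factorial : ℂ)

theorem binomCoeff_zero (s : ℂ) : binomCoeff s 0 = 1 := by
  simp [binomCoeff]

theorem binomCoeff_succ_mul (s : ℂ) (j : ℕ) :
    binomCoeff s (j + 1) * (j + 1) = -s * binomCoeff (s + 1) j := by
  have h1 : (j.factorial : ℂ) ≠ 0 := by exact_mod_cast j.factorial_ne_zero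
  have h2 : (j : ℂ) + 1 ≠ 0 := by exact_mod_cast j.succ_ne_zero
  rw [binomCoeff, binomCoeff, ascPochhammer_succ_left, Nat.factorial_succ]
  simp only [Polynomial.eval_mul, Polynomial.eval_X, Polynomial.eval_comp, Polynomial.eval_add,
    Polynomial.eval_one]
  push_cast
  field_simp
  ring

theorem differentiable_binomCoeff (j : ℕ) : Differentiable ℂ fun s => binomCoeff s j := by
  unfold binomCoeff
  fun_prop

/-- The remainder of the binomial series of `(1 + x) ^ (-s)` after `n` terms. -/
noncomputable def binomRem (n : ℕ) (s x : ℂ) : ℂ :=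
  (1 + x) ^ (-s) - ∑ j ∈ Finset.range n, binomCoeff s j * x ^ j

theorem hasDerivAt_binomRem (n : ℕ) (s : ℂ) {x : ℂ} (hx : 1 + x ∈ Complex.slitPlane) :
    HasDerivAt (binomRem (n + 1) s) (-s * binomRem n (s + 1) x) x := by
  have h1 : HasDerivAt (fun x : ℂ => (1 + x) ^ (-s)) (-s * (1 + x) ^ (-s - 1) * 1) x :=
    ((hasDerivAt_id x).const_add 1).cpow_const hx
  have h2 : HasDerivAt (fun x : ℂ => ∑ j ∈ Finset.range (n + 1), binomCoeff s j * x ^ j)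
      (∑ j ∈ Finset.range (n + 1), binomCoeff s j * (j * x ^ (j - 1))) x :=
    HasDerivAt.fun_sum fun j _ => (hasDerivAt_pow j x).const_mul _
  refine (h1.sub h2).congr_deriv ?_
  rw [Finset.sum_range_succ', binomRem, mul_sub, Finset.mul_sum]
  simp only [Nat.cast_zero, zero_mul, mul_zero, add_zero, mul_one, Nat.add_sub_cancel]
  congr 1
  · congr 2
    ring
  · refine Finset.sum_congr rfl fun j _ => ?_
    have := binomCoeff_succ_mul s j
    push_cast
    linear_combination x ^ j * this

theorem binomRem_succ_zero (n : ℕ) (s : ℂ) : binomRem (n + 1) s 0 = 0 := by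
  rw [binomRem, Finset.sum_range_succ']
  simp [binomCoeff_zero]

/-- Induction by integrating the derivative from `0`, where the remainder vanishes. Differentiation
replaces `s` by `s + 1`, so the bound `M` on `‖s‖` must vary in the induction. -/
theorem exists_norm_binomRem_le (n : ℕ) (M : ℝ) :
    ∃ C : ℝ, 0 ≤ C ∧ ∀ s : ℂ, ‖s‖ ≤ M → ∀ x : ℝ, 0 ≤ x → x ≤ 1 →
      ‖binomRem n s x‖ ≤ C * x ^ n := by
  induction n generalizing M with
  | zero =>
    refine ⟨2 ^ M, by positivity, fun s hs x hx0 hx1 => ?_⟩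
    have h1 : (1 + x : ℂ) = ((1 + x : ℝ) : ℂ) := by push_cast; rfl
    rw [binomRem, Finset.sum_range_zero, sub_zero, h1,
      Complex.norm_cpow_eq_rpow_re_of_pos (by linarith), pow_zero, mul_one]
    have h2 : (-s).re ≤ M := ((Complex.re_le_norm _).trans (norm_neg s).le).trans hs
    calc (1 + x) ^ (-s).re ≤ (1 + x) ^ M := Real.rpow_le_rpow_of_exponent_le (by linarith) h2
      _ ≤ 2 ^ M := Real.rpow_le_rpow (by linarith) (by linarith) ((norm_nonneg s).trans hs)
  | succ n ih =>
    obtain ⟨C, hC, h⟩ := ih (M + 1)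
    refine ⟨|M| * C, by positivity, fun s hs x hx0 hx1 => ?_⟩
    have hs1 : ‖s + 1‖ ≤ M + 1 := (norm_add_le _ _).trans (by simpa using hs)
    have hd : ∀ y ∈ Set.Icc (0 : ℝ) x, HasDerivWithinAt (fun y : ℝ => binomRem (n + 1) s y)
        (-s * binomRem n (s + 1) y) (Set.Icc 0 x) y := by
      intro y hy
      refine (hasDerivAt_binomRem n s ?_).comp_ofReal.hasDerivWithinAt
      rw [← Complex.ofReal_one, ← Complex.ofReal_add, Complex.ofReal_mem_slitPlane]
      linarith [hy.1]
    have hb : ∀ y ∈ Set.Ico (0 : ℝ) x, ‖-s * binomRem n (s + 1) y‖ ≤ |M| * C * x ^ n := by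
      intro y hy
      rw [norm_mul, norm_neg, mul_assoc]
      refine mul_le_mul (hs.trans (le_abs_self _)) ?_ (norm_nonneg _) (abs_nonneg _)
      refine (h (s + 1) hs1 y hy.1 (hy.2.le.trans hx1)).trans ?_
      exact mul_le_mul_of_nonneg_left (pow_le_pow_left₀ hy.1 hy.2.le n) hC
    have := norm_image_sub_le_of_norm_deriv_le_segment' hd hb x (Set.right_mem_Icc.2 hx0)
    rw [Complex.ofReal_zero, binomRem_succ_zero, sub_zero, sub_zero] at this
    rwa [pow_succ, ← mul_assoc]

theorem differentiable_binomRem (n : ℕ) (x : ℝ) (hx : 0 ≤ x) :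
    Differentiable ℂ fun s => binomRem n s x := by
  have h1 : (1 + x : ℂ) ≠ 0 := by
    have : (1 + x : ℝ) ≠ 0 := by positivity
    exact_mod_cast this
  have := differentiable_binomCoeff
  unfold binomRem
  refine Differentiable.sub (fun s => ?_) ?_
  · exact (differentiableAt_id.neg).const_cpow (Or.inl h1)
  · exact Differentiable.fun_sum fun j _ => (this j).mul_const _

/-! ### Analyticity of the remainder series and of the Dirichlet series. -/

/-- The terms of the series of remainders `remSeries`. -/
noncomputable def remTerm (b : ℕ) (A : Finset ℕ) (n : ℕ) (s : ℂ) : ℕ → ℂ :=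
  Set.indicator {m | Admissible b A m} fun m =>
    (m : ℂ) ^ (-s) * ∑ a ∈ A, binomRem n s ((a / (b * m) : ℝ) : ℂ)

/-- The part of the functional equation of the restricted Dirichlet series which comes from the
remainders of the binomial series after `n` terms. -/
noncomputable def remSeries (b : ℕ) (A : Finset ℕ) (n : ℕ) (s : ℂ) : ℂ :=
  ∑' m, remTerm b A n s m

/-- Since `a / (b * m) ≤ 1 / m`, removing `n` binomial terms gains a factor `m ^ (-n)`. The constant
is uniform on `‖s‖ ≤ M`, as needed for locally uniform convergence. -/
theorem exists_norm_remTerm_le {b : ℕ} {A : Finset ℕ} (hA : ∀ a ∈ A, a < b) (n : ℕ) (M : ℝ) :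
    ∃ C : ℝ, 0 ≤ C ∧ ∀ s : ℂ, ‖s‖ ≤ M → ∀ σ : ℝ, σ ≤ s.re + n → ∀ m : ℕ,
      ‖remTerm b A n s m‖ ≤
        C * Set.indicator {n | Admissible b A n} (fun n : ℕ => (n : ℝ) ^ (-σ)) m := by
  obtain ⟨C, hC, h⟩ := exists_norm_binomRem_le n M
  refine ⟨A.card * C, by positivity, fun s hs σ hσ m => ?_⟩
  rw [remTerm]
  by_cases hm : Admissible b A m
  swap
  · rw [Set.indicator_of_notMem (by exact hm), Set.indicator_of_notMem (by exact hm)]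
    simp
  rw [Set.indicator_of_mem (by exact hm), Set.indicator_of_mem (by exact hm), norm_mul]
  have hm1 : (1 : ℝ) ≤ m := by exact_mod_cast hm.1
  have hm0 : (0 : ℝ) < m := by linarith
  have h1 : ‖∑ a ∈ A, binomRem n s ((a / (b * m) : ℝ) : ℂ)‖ ≤
      A.card * (C * ((m : ℝ)⁻¹) ^ n) := by
    rw [← nsmul_eq_mul A.card, ← Finset.sum_const]
    refine norm_sum_le_of_le _ fun a ha => ?_
    have hb0 : (0 : ℝ) < b := by exact_mod_cast (Nat.zero_le a).trans_lt (hA a ha)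
    have hab : (a : ℝ) ≤ b := by exact_mod_cast (hA a ha).le
    have hx : (a / (b * m) : ℝ) ≤ (m : ℝ)⁻¹ := by
      rw [inv_eq_one_div, div_le_div_iff₀ (by positivity) hm0]
      nlinarith
    have hx0 : (0 : ℝ) ≤ a / (b * m) := by positivity
    refine (h s hs _ hx0 (hx.trans (inv_le_one_of_one_le₀ hm1))).trans ?_
    gcongr
  have h2 : ‖(m : ℂ) ^ (-s)‖ = (m : ℝ) ^ (-s.re) := by
    rw [← Complex.ofReal_natCast, Complex.norm_cpow_eq_rpow_re_of_pos hm0, Complex.neg_re]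
  rw [h2]
  calc (m : ℝ) ^ (-s.re) * ‖∑ a ∈ A, binomRem n s ((a / (b * m) : ℝ) : ℂ)‖
      ≤ (m : ℝ) ^ (-s.re) * (A.card * (C * ((m : ℝ)⁻¹) ^ n)) := by gcongr
    _ = A.card * C * (m : ℝ) ^ (-s.re - n) := by
        rw [Real.rpow_sub hm0, Real.rpow_natCast, inv_pow]
        ring
    _ ≤ A.card * C * (m : ℝ) ^ (-σ) := by
        refine mul_le_mul_of_nonneg_left ?_ (by positivity)
        exact Real.rpow_le_rpow_of_exponent_le hm1 (by linarith)

theorem natCast_cpow_differentiable {m : ℕ} (hm : m ≠ 0) :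
    Differentiable ℂ fun s : ℂ => (m : ℂ) ^ (-s) :=
  fun _ => (differentiableAt_id.neg).const_cpow (Or.inl (by exact_mod_cast hm))

theorem differentiable_remTerm (b : ℕ) (A : Finset ℕ) (n m : ℕ) :
    Differentiable ℂ fun s => remTerm b A n s m := by
  unfold remTerm
  by_cases hm : Admissible b A m
  · simp only [Set.indicator_of_mem (show m ∈ {m | Admissible b A m} from hm)]
    exact (natCast_cpow_differentiable hm.1.ne').mul
      (Differentiable.fun_sum fun a _ => differentiable_binomRem n _ (by positivity))
  · simp only [Set.indicator_of_notMem (show m ∉ {m | Admissible b A m} from hm)]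
    exact differentiable_const _

theorem analyticAt_remSeries {b : ℕ} (hb : 1 < b) {A : Finset ℕ} (hA : ∀ a ∈ A, a < b)
    (hN : 0 < A.card) (n : ℕ) {s₁ : ℂ} (hs₁ : abscissa b A < s₁.re + n) :
    AnalyticAt ℂ (remSeries b A n) s₁ := by
  obtain ⟨σ, hσ, hσ'⟩ := exists_between hs₁
  obtain ⟨C, hC, h⟩ := exists_norm_remTerm_le (b := b) hA n (‖s₁‖ + 1)
  have hU : IsOpen (Metric.ball s₁ 1 ∩ {s | σ < s.re + n}) :=
    Metric.isOpen_ball.inter (isOpen_lt continuous_const (by fun_prop))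
  have hd : DifferentiableOn ℂ (remSeries b A n) (Metric.ball s₁ 1 ∩ {s | σ < s.re + n}) := by
    refine Complex.differentiableOn_tsum_of_summable_norm
      ((summable_rpow hb hA hN hσ).mul_left C)
      (fun m => (differentiable_remTerm b A n m).differentiableOn) hU ?_
    rintro m s ⟨hs, hs'⟩
    refine h s ?_ σ (le_of_lt hs') m
    have := norm_add_le s₁ (s - s₁)
    rw [add_sub_cancel] at this
    rw [Metric.mem_ball, dist_eq_norm] at hs
    linarith
  exact hd.analyticAt (hU.mem_nhds ⟨Metric.mem_ball_self one_pos, hσ'⟩)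

theorem summable_remTerm {b : ℕ} (hb : 1 < b) {A : Finset ℕ} (hA : ∀ a ∈ A, a < b)
    (hN : 0 < A.card) (n : ℕ) {s : ℂ} (hs : abscissa b A < s.re + n) :
    Summable (remTerm b A n s) := by
  obtain ⟨C, hC, h⟩ := exists_norm_remTerm_le (b := b) hA n ‖s‖
  exact ((summable_rpow hb hA hN hs).mul_left C).of_norm_bounded (h s le_rfl _ le_rfl)

theorem norm_term (b : ℕ) (A : Finset ℕ) (s : ℂ) (m : ℕ) :
    ‖term b A s m‖ =
      Set.indicator {n | Admissible b A n} (fun n : ℕ => (n : ℝ) ^ (-s.re)) m := by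
  rw [term]
  by_cases hm : Admissible b A m
  · rw [Set.indicator_of_mem (by exact hm), Set.indicator_of_mem (by exact hm),
      ← Complex.ofReal_natCast, Complex.norm_cpow_eq_rpow_re_of_pos (by exact_mod_cast hm.1),
      Complex.neg_re]
  · rw [Set.indicator_of_notMem (by exact hm), Set.indicator_of_notMem (by exact hm), norm_zero]

theorem summable_term {b : ℕ} (hb : 1 < b) {A : Finset ℕ} (hA : ∀ a ∈ A, a < b)
    (hN : 0 < A.card) {s : ℂ} (hs : abscissa b A < s.re) : Summable (term b A s) := by
  refine Summable.of_norm ?_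
  simp only [norm_term]
  exact summable_rpow hb hA hN hs

theorem analyticAt_tsum_term {b : ℕ} (hb : 1 < b) {A : Finset ℕ} (hA : ∀ a ∈ A, a < b)
    (hN : 0 < A.card) {s₁ : ℂ} (hs₁ : abscissa b A < s₁.re) :
    AnalyticAt ℂ (fun s => ∑' m, term b A s m) s₁ := by
  obtain ⟨σ, hσ, hσ'⟩ := exists_between hs₁
  have hU : IsOpen {s : ℂ | σ < s.re} := isOpen_lt continuous_const (by fun_prop)
  have hd : DifferentiableOn ℂ (fun s => ∑' m, term b A s m) {s : ℂ | σ < s.re} := by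
    refine Complex.differentiableOn_tsum_of_summable_norm (summable_rpow hb hA hN hσ) (fun m => ?_) hU ?_
    · refine Differentiable.differentiableOn ?_
      unfold term
      by_cases hm : Admissible b A m
      · simp only [Set.indicator_of_mem (show m ∈ {m | Admissible b A m} from hm)]
        exact natCast_cpow_differentiable hm.1.ne'
      · simp only [Set.indicator_of_notMem (show m ∉ {m | Admissible b A m} from hm)]
        exact differentiable_const _
    · intro m s hs
      rw [norm_term]
      by_cases hm : Admissible b A m
      · rw [Set.indicator_of_mem (by exact hm), Set.indicator_of_mem (by exact hm)]
        exact Real.rpow_le_rpow_of_exponent_le (by exact_mod_cast hm.1) (neg_le_neg (le_of_lt hs))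
      · rw [Set.indicator_of_notMem (by exact hm), Set.indicator_of_notMem (by exact hm)]
  exact hd.analyticAt (hU.mem_nhds hσ')

/-! ### The functional equation in the half plane of convergence. -/

/-- The contribution of the one-digit numbers. -/
noncomputable def digitSum (A : Finset ℕ) (s : ℂ) : ℂ :=
  ∑ a ∈ A.erase 0, (a : ℂ) ^ (-s)

theorem differentiable_digitSum (A : Finset ℕ) : Differentiable ℂ (digitSum A) :=
  Differentiable.fun_sum fun _ ha => natCast_cpow_differentiable (Finset.mem_erase.1 ha).1

theorem sum_cpow_mul_add {b : ℕ} (hb : 1 < b) (A : Finset ℕ) (n : ℕ) (s : ℂ) {m : ℕ}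
    (hm : 0 < m) :
    ∑ a ∈ A, ((b * m + a : ℕ) : ℂ) ^ (-s) = (b : ℂ) ^ (-s) *
      (∑ j ∈ Finset.range n, binomCoeff s j * powerSum A j * ((b : ℂ) ^ j)⁻¹ *
          (m : ℂ) ^ (-(s + j)) +
        (m : ℂ) ^ (-s) * ∑ a ∈ A, binomRem n s ((a / (b * m) : ℝ) : ℂ)) := by
  have hm0 : (0 : ℝ) < m := by exact_mod_cast hm
  have hb0 : (0 : ℝ) < b := by exact_mod_cast (by omega : 0 < b)
  have hmC : (m : ℂ) ≠ 0 := by exact_mod_cast hm.ne'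
  have hbC : (b : ℂ) ≠ 0 := by exact_mod_cast (by omega : b ≠ 0)
  have h1 : ∀ a ∈ A, ((b * m + a : ℕ) : ℂ) ^ (-s) = (b : ℂ) ^ (-s) * ((m : ℂ) ^ (-s) *
      (∑ j ∈ Finset.range n, binomCoeff s j * ((a / (b * m) : ℝ) : ℂ) ^ j +
        binomRem n s ((a / (b * m) : ℝ) : ℂ))) := by
    -- The power of `b * m * (1 + a / (b * m))` splits without any branch correction because all
    -- three factors are nonnegative reals.
    intro a _
    rw [binomRem, add_sub_cancel, ← Complex.ofReal_natCast b, ← Complex.ofReal_natCast m,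
      ← Complex.ofReal_one, ← Complex.ofReal_add, ← Complex.mul_cpow_ofReal_nonneg hm0.le
      (by positivity), ← Complex.ofReal_mul, ← Complex.mul_cpow_ofReal_nonneg hb0.le
      (by positivity), ← Complex.ofReal_mul, ← Complex.ofReal_natCast]
    congr 2
    push_cast
    field_simp
  rw [Finset.sum_congr rfl h1, ← Finset.mul_sum, ← Finset.mul_sum, Finset.sum_add_distrib, mul_add]
  congr 2
  rw [Finset.sum_comm, Finset.mul_sum]
  refine Finset.sum_congr rfl fun j _ => ?_
  rw [powerSum, ← Finset.mul_sum, neg_add, ← sub_eq_add_neg, Complex.cpow_sub _ _ hmC,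
    Complex.cpow_natCast]
  have h2 : ∀ a ∈ A, (((a / (b * m) : ℝ) : ℂ)) ^ j =
      (a : ℂ) ^ j * (((b : ℂ) ^ j)⁻¹ * ((m : ℂ) ^ j)⁻¹) := by
    intro a _
    push_cast
    rw [div_pow, mul_pow, div_eq_mul_inv, mul_inv]
  rw [Finset.sum_congr rfl h2, ← Finset.sum_mul]
  ring

theorem tsum_term_eq {b : ℕ} (hb : 1 < b) {A : Finset ℕ} (hA : ∀ a ∈ A, a < b)
    (hN : 0 < A.card) (n : ℕ) {s : ℂ} (hs : abscissa b A < s.re) :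
    ∑' m, term b A s m = digitSum A s + (b : ℂ) ^ (-s) *
      (∑ j ∈ Finset.range n, binomCoeff s j * powerSum A j * ((b : ℂ) ^ j)⁻¹ *
          ∑' m, term b A (s + j) m +
        remSeries b A n s) := by
  have h1 := hasSum_indicator_admissible hb hA (summable_term hb hA hN hs).hasSum
  have h2 : ∀ j ∈ Finset.range n,
      HasSum (fun m => binomCoeff s j * powerSum A j * ((b : ℂ) ^ j)⁻¹ * term b A (s + j) m)
        (binomCoeff s j * powerSum A j * ((b : ℂ) ^ j)⁻¹ * ∑' m, term b A (s + j) m) := by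
    intro j _
    refine ((summable_term hb hA hN ?_).hasSum).mul_left _
    have : (0 : ℝ) ≤ j := by positivity
    simp
    linarith
  have h3 := (((hasSum_sum h2).add (summable_remTerm hb hA hN n (s := s) (by
    have : (0 : ℝ) ≤ n := by positivity
    linarith)).hasSum).mul_left ((b : ℂ) ^ (-s)))
  have h4 := h1.unique (h3.congr_fun fun m => ?_)
  · rw [sub_eq_iff_eq_add'] at h4
    exact h4
  · by_cases hm : Admissible b A m
    · simp only [remTerm, term]
      rw [Set.indicator_of_mem (by exact hm), Set.indicator_of_mem (by exact hm),
        sum_cpow_mul_add hb A n s hm.1]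
      simp only [Set.indicator_of_mem (show m ∈ {m | Admissible b A m} from hm)]
    · simp only [remTerm, term]
      simp only [Set.indicator_of_notMem (show m ∉ {m | Admissible b A m} from hm)]
      simp

/-! ### Calculus of simple poles and residues. -/

/-- At `z₀` the function `f` has at most a simple pole, with residue `c`. -/
def HasSimpleResidue (f : ℂ → ℂ) (z₀ c : ℂ) : Prop :=
  ∃ g : ℂ → ℂ, AnalyticAt ℂ g z₀ ∧ f =ᶠ[𝓝[≠] z₀] (fun z => (z - z₀)⁻¹ * g z) ∧ g z₀ = c

namespace HasSimpleResidue

variable {f f₁ f₂ u : ℂ → ℂ} {z₀ c c₁ c₂ : ℂ}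

/-- By Cauchy's formula the normalized circle integral already equals `c` for all sufficiently small
radii, so the limit is that of an eventually constant function. -/
theorem residue_eq (h : HasSimpleResidue f z₀ c) : residue f z₀ = c := by
  obtain ⟨g, hg, hfg, rfl⟩ := h
  refine Tendsto.limUnder_eq (tendsto_const_nhds.congr' ?_)
  have h1 : ∀ᶠ z in 𝓝 z₀, DifferentiableAt ℂ g z ∧ (z ≠ z₀ → f z = (z - z₀)⁻¹ * g z) :=
    (hg.eventually_analyticAt.mono fun z hz => hz.differentiableAt).and
      (eventually_nhdsWithin_iff.1 hfg)
  obtain ⟨ε, hε, hball⟩ := Metric.eventually_nhds_iff_ball.1 h1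
  filter_upwards [Ioo_mem_nhdsGT hε] with r hr
  have h2 : ∮ z in C(z₀, r), f z = ∮ z in C(z₀, r), (z - z₀)⁻¹ • g z := by
    refine circleIntegral.integral_congr hr.1.le fun z hz => ?_
    have hz' : dist z z₀ = r := hz
    refine (hball z ?_).2 ?_
    · rw [Metric.mem_ball, hz']
      exact hr.2
    · rintro rfl
      rw [dist_self] at hz'
      exact hr.1.ne hz'
  have h3 : DifferentiableOn ℂ g (Metric.closedBall z₀ r) := fun z hz =>
    (hball z (Metric.closedBall_subset_ball hr.2 hz)).1.differentiableWithinAt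
  rw [h2, h3.circleIntegral_sub_inv_smul (Metric.mem_ball_self hr.1), smul_eq_mul,
    inv_mul_cancel_left₀ Complex.two_pi_I_ne_zero]

theorem meromorphicAt (h : HasSimpleResidue f z₀ c) : MeromorphicAt f z₀ := by
  obtain ⟨g, hg, hfg, rfl⟩ := h
  refine MeromorphicAt.congr ?_ hfg.symm
  exact ((analyticAt_id.sub analyticAt_const).meromorphicAt.inv).mul hg.meromorphicAt

theorem isPole_iff (h : HasSimpleResidue f z₀ c) : IsPole f z₀ ↔ c ≠ 0 := by
  have hm := h.meromorphicAt
  obtain ⟨g, hg, hfg, rfl⟩ := h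
  rw [IsPole, and_iff_right hm]
  constructor
  · intro hlt h0
    -- A numerator vanishing at `z₀` cancels the denominator, leaving its divided slope as an
    -- analytic extension.
    refine hlt.not_ge (hm.meromorphicOrderAt_nonneg_iff.2 ⟨dslope g z₀, ?_, ?_⟩)
    · obtain ⟨p, hp⟩ := hg
      exact hp.has_fpower_series_dslope_fslope.analyticAt
    · filter_upwards [hfg, self_mem_nhdsWithin] with z hz hne
      have := sub_smul_dslope g z₀ z
      rw [h0, sub_zero, smul_eq_mul] at this
      rw [hz, ← this, inv_mul_cancel_left₀ (sub_ne_zero.2 hne)]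
  · intro h0
    have : meromorphicOrderAt f z₀ = ((-1 : ℤ) : WithTop ℤ) := by
      refine (meromorphicOrderAt_eq_int_iff hm).2 ⟨g, hg, h0, ?_⟩
      filter_upwards [hfg] with z hz
      rw [hz, zpow_neg_one, smul_eq_mul]
    rw [this]
    exact_mod_cast (by norm_num : (-1 : ℤ) < 0)

theorem congr (h : HasSimpleResidue f₁ z₀ c) (he : f₂ =ᶠ[𝓝[≠] z₀] f₁) :
    HasSimpleResidue f₂ z₀ c := by
  obtain ⟨g, hg, hfg, rfl⟩ := h
  exact ⟨g, hg, he.trans hfg, rfl⟩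

theorem of_analyticAt (h : AnalyticAt ℂ f z₀) : HasSimpleResidue f z₀ 0 := by
  refine ⟨fun z => (z - z₀) * f z, by fun_prop, ?_, by simp⟩
  filter_upwards [self_mem_nhdsWithin] with z hne
  rw [inv_mul_cancel_left₀ (sub_ne_zero.2 hne)]

theorem add (h₁ : HasSimpleResidue f₁ z₀ c₁) (h₂ : HasSimpleResidue f₂ z₀ c₂) :
    HasSimpleResidue (fun z => f₁ z + f₂ z) z₀ (c₁ + c₂) := by
  obtain ⟨g₁, hg₁, hfg₁, rfl⟩ := h₁
  obtain ⟨g₂, hg₂, hfg₂, rfl⟩ := h₂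
  refine ⟨fun z => g₁ z + g₂ z, hg₁.add hg₂, ?_, rfl⟩
  filter_upwards [hfg₁, hfg₂] with z h1 h2
  rw [h1, h2, mul_add]

theorem analyticAt_mul (hu : AnalyticAt ℂ u z₀) (h : HasSimpleResidue f z₀ c) :
    HasSimpleResidue (fun z => u z * f z) z₀ (u z₀ * c) := by
  obtain ⟨g, hg, hfg, rfl⟩ := h
  refine ⟨fun z => u z * g z, hu.mul hg, ?_, rfl⟩
  filter_upwards [hfg] with z h1
  rw [h1, mul_left_comm]

theorem sum {ι : Type*} {F : ι → ℂ → ℂ} {C : ι → ℂ} (S : Finset ι)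
    (h : ∀ i ∈ S, HasSimpleResidue (F i) z₀ (C i)) :
    HasSimpleResidue (fun z => ∑ i ∈ S, F i z) z₀ (∑ i ∈ S, C i) := by
  classical
  induction S using Finset.induction_on with
  | empty => simpa using of_analyticAt (analyticAt_const (v := (0 : ℂ)))
  | insert i S hi ih =>
    simp only [Finset.sum_insert hi]
    exact (h i (Finset.mem_insert_self i S)).add
      (ih fun j hj => h j (Finset.mem_insert_of_mem hj))

theorem comp_add (w : ℂ) (h : HasSimpleResidue f (z₀ + w) c) :
    HasSimpleResidue (fun z => f (z + w)) z₀ c := by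
  obtain ⟨g, hg, hfg, rfl⟩ := h
  refine ⟨fun z => g (z + w), hg.comp_of_eq (f := fun z => z + w) (by fun_prop) rfl, ?_, rfl⟩
  rw [eventuallyEq_nhdsWithin_iff] at hfg ⊢
  have ht : Tendsto (fun z : ℂ => z + w) (𝓝 z₀) (𝓝 (z₀ + w)) :=
    (continuous_add_const w).tendsto z₀
  filter_upwards [ht.eventually hfg] with z hz hne
  rw [hz (by simpa using hne), add_sub_add_right_eq_sub]

theorem of_mul (hu : AnalyticAt ℂ u z₀) (hu0 : u z₀ ≠ 0)
    (h : HasSimpleResidue (fun z => u z * f z) z₀ c) : HasSimpleResidue f z₀ (c / u z₀) := by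
  have h1 := (h.analyticAt_mul (hu.inv hu0)).congr (f₂ := f) ?_
  · rwa [Pi.inv_apply, inv_mul_eq_div] at h1
  · filter_upwards [(hu.continuousAt.eventually_ne hu0).filter_mono nhdsWithin_le_nhds] with z hz
    rw [Pi.inv_apply, inv_mul_cancel_left₀ hz]

theorem of_mul_of_simple_zero {φ : ℂ → ℂ} (hu : AnalyticAt ℂ u z₀) (hu0 : u z₀ = 0)
    (hu' : deriv u z₀ ≠ 0) (hφ : AnalyticAt ℂ φ z₀)
    (h : (fun z => u z * f z) =ᶠ[𝓝[≠] z₀] φ) : HasSimpleResidue f z₀ (φ z₀ / deriv u z₀) := by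
  have hd : AnalyticAt ℂ (dslope u z₀) z₀ := by
    obtain ⟨p, hp⟩ := hu
    exact hp.has_fpower_series_dslope_fslope.analyticAt
  have hd0 : dslope u z₀ z₀ ≠ 0 := by rwa [dslope_same]
  refine ⟨fun z => φ z / dslope u z₀ z, hφ.div hd hd0, ?_, by simp only [dslope_same]⟩
  filter_upwards [h, self_mem_nhdsWithin,
    (hd.continuousAt.eventually_ne hd0).filter_mono nhdsWithin_le_nhds] with z hz hne hz'
  have h1 := sub_smul_dslope u z₀ z
  rw [hu0, sub_zero, smul_eq_mul] at h1
  have h2 : z - z₀ ≠ 0 := sub_ne_zero.2 hne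
  rw [← hz, ← h1]
  field_simp

end HasSimpleResidue

/-! ### Functional equation and meromorphic continuation. -/

/-- The identity theorem for meromorphic functions on a half plane. -/
theorem eventuallyEq_of_eqOn_halfPlane {f g : ℂ → ℂ} {x y : ℝ}
    (hf : ∀ z : ℂ, x < z.re → MeromorphicAt f z) (hg : ∀ z : ℂ, x < z.re → MeromorphicAt g z)
    (h : ∀ z : ℂ, y < z.re → f z = g z) {z : ℂ} (hz : x < z.re) : f =ᶠ[𝓝[≠] z] g := by
  have hm : MeromorphicOn (fun z => f z - g z) {z : ℂ | x < z.re} := fun w hw =>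
    (hf w hw).fun_sub (hg w hw)
  set w : ℂ := ((max x y + 1 : ℝ) : ℂ) with hw
  have hwx : x < w.re := by
    rw [hw, Complex.ofReal_re]
    linarith [le_max_left x y]
  have hwy : y < w.re := by
    rw [hw, Complex.ofReal_re]
    linarith [le_max_right x y]
  have h1 : meromorphicOrderAt (fun z => f z - g z) w = ⊤ := by
    rw [meromorphicOrderAt_eq_top_iff]
    have : ∀ᶠ z : ℂ in 𝓝 w, y < z.re :=
      (isOpen_lt continuous_const Complex.continuous_re).mem_nhds hwy
    filter_upwards [this.filter_mono nhdsWithin_le_nhds] with z hz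
    rw [h z hz, sub_self]
  have h2 : meromorphicOrderAt (fun z => f z - g z) z = ⊤ := by
    by_contra hne
    exact hm.meromorphicOrderAt_ne_top_of_isPreconnected
      (convex_halfSpace_re_gt x).isPreconnected hz hwx hne h1
  filter_upwards [meromorphicOrderAt_eq_top_iff.1 h2] with z hz
  exact sub_eq_zero.1 hz

/-- The factor `1 - N b ^ (-s)` of the functional equation. -/
noncomputable def eulerFactor (b : ℕ) (A : Finset ℕ) (s : ℂ) : ℂ :=
  1 - (A.card : ℂ) * (b : ℂ) ^ (-s)

/-- The right-hand side of the functional equation satisfied by the restricted Dirichlet series. -/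
noncomputable def functionalRHS (b : ℕ) (A : Finset ℕ) (n : ℕ) (F : ℂ → ℂ) (s : ℂ) : ℂ :=
  digitSum A s + (b : ℂ) ^ (-s) *
    (∑ j ∈ Finset.Icc 1 n, binomCoeff s j * powerSum A j * ((b : ℂ) ^ j)⁻¹ * F (s + j) +
      remSeries b A (n + 1) s)

theorem differentiable_eulerFactor {b : ℕ} (hb : 1 < b) (A : Finset ℕ) :
    Differentiable ℂ (eulerFactor b A) :=
  (differentiable_const _).sub ((natCast_cpow_differentiable (by omega)).const_mul _)

theorem eulerFactor_ne_zero {b : ℕ} (hb : 1 < b) {A : Finset ℕ} (hN : 0 < A.card) {s : ℂ}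
    (hs : abscissa b A < s.re) : eulerFactor b A s ≠ 0 := by
  have h1 : ‖(A.card : ℂ) * (b : ℂ) ^ (-s)‖ < 1 := by
    rw [norm_mul, ← Complex.ofReal_natCast b, Complex.norm_cpow_eq_rpow_re_of_pos
      (by exact_mod_cast (by omega : 0 < b)), Complex.norm_natCast, Complex.neg_re]
    exact card_mul_rpow_neg_lt_one hb hN hs
  intro h0
  rw [eulerFactor, sub_eq_zero] at h0
  rw [← h0, norm_one] at h1
  exact lt_irrefl _ h1

theorem eulerFactor_mul_tsum_term {b : ℕ} (hb : 1 < b) {A : Finset ℕ} (hA : ∀ a ∈ A, a < b)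
    (hN : 0 < A.card) (n : ℕ) {s : ℂ} (hs : abscissa b A < s.re) :
    eulerFactor b A s * ∑' m, term b A s m =
      functionalRHS b A n (fun s => ∑' m, term b A s m) s := by
  have h := tsum_term_eq hb hA hN (n + 1) hs
  have hI : Finset.Ico (0 + 1) (n + 1) = Finset.Icc 1 n := by
    ext
    simp only [Finset.mem_Ico, Finset.mem_Icc]
    omega
  have hγ : powerSum A 0 = A.card := by simp [powerSum]
  rw [Finset.range_eq_Ico, Finset.sum_eq_sum_Ico_succ_bot n.succ_pos, hI, binomCoeff_zero, hγ,
    pow_zero, Nat.cast_zero, add_zero] at h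
  rw [eulerFactor, functionalRHS]
  linear_combination h

theorem functionalRHS_congr {b : ℕ} {A : Finset ℕ} {n : ℕ} {F G : ℂ → ℂ} {s : ℂ}
    (h : ∀ j ∈ Finset.Icc 1 n, F (s + j) = G (s + j)) :
    functionalRHS b A n F s = functionalRHS b A n G s := by
  rw [functionalRHS, functionalRHS, Finset.sum_congr rfl fun j hj => by rw [h j hj]]

section

variable {b : ℕ} {A : Finset ℕ}

theorem meromorphicAt_functionalRHS (hb : 1 < b) (hA : ∀ a ∈ A, a < b) (hN : 0 < A.card)
    {n : ℕ} {F : ℂ → ℂ} {s : ℂ} (hs : abscissa b A < s.re + (n + 1))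
    (hF : ∀ j ∈ Finset.Icc 1 n, MeromorphicAt F (s + j)) :
    MeromorphicAt (functionalRHS b A n F) s := by
  have h1 := ((differentiable_digitSum A).analyticAt s).meromorphicAt
  have h2 := ((natCast_cpow_differentiable (by omega : b ≠ 0)).analyticAt s).meromorphicAt
  have h3 := (analyticAt_remSeries hb hA hN (n + 1) (by push_cast; exact hs)).meromorphicAt
  refine h1.fun_add (h2.fun_mul (MeromorphicAt.fun_add (MeromorphicAt.fun_sum fun j hj => ?_) h3))
  have h4 := ((differentiable_binomCoeff j).analyticAt s).meromorphicAt
  refine ((h4.fun_mul (.const _ _)).fun_mul (.const _ _)).fun_mul ?_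
  exact (hF j hj).comp_analyticAt (g := fun z : ℂ => z + j) (by fun_prop)

/-- The right-hand side evaluates `F` only at `s + j` with `j ≥ 1`, so dividing by the Euler factor
gains one unit strip. -/
theorem exists_meromorphic_halfPlane (hb : 1 < b) (hA : ∀ a ∈ A, a < b) (hN : 0 < A.card)
    (n : ℕ) : ∃ F : ℂ → ℂ, (∀ z : ℂ, abscissa b A - n < z.re → MeromorphicAt F z) ∧
      ∀ z : ℂ, abscissa b A < z.re → F z = ∑' m, term b A z m := by
  induction n with
  | zero =>
    refine ⟨fun z => ∑' m, term b A z m, fun z hz => ?_, fun _ _ => rfl⟩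
    exact (analyticAt_tsum_term hb hA hN (by simpa using hz)).meromorphicAt
  | succ n ih =>
    obtain ⟨F, hF, hF'⟩ := ih
    refine ⟨fun z => (eulerFactor b A z)⁻¹ * functionalRHS b A n F z, fun z hz => ?_,
      fun z hz => ?_⟩
    · push_cast at hz
      refine (((differentiable_eulerFactor hb A).analyticAt z).meromorphicAt.inv).mul
        (meromorphicAt_functionalRHS hb hA hN (by linarith) fun j hj => hF _ ?_)
      have : (1 : ℝ) ≤ j := by exact_mod_cast (Finset.mem_Icc.1 hj).1
      simp
      linarith
    · rw [inv_mul_eq_iff_eq_mul₀ (eulerFactor_ne_zero hb hN hz),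
        eulerFactor_mul_tsum_term hb hA hN n hz]
      refine functionalRHS_congr fun j hj => hF' _ ?_
      have : (1 : ℝ) ≤ j := by exact_mod_cast (Finset.mem_Icc.1 hj).1
      simp
      linarith

theorem exists_isMeromorphicContinuation (hb : 1 < b) (hA : ∀ a ∈ A, a < b) (hN : 0 < A.card) :
    ∃ K : ℂ → ℂ, IsMeromorphicContinuation b A K := by
  choose F hF hF' using exists_meromorphic_halfPlane hb hA hN
  -- The `+ 1` puts every point `s` within horizontal distance less than `1` of `z` in the half
  -- plane of the continuation chosen at `z`. Near a fixed `s` only finitely many indices occur, all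
  -- at most the `N` below, and each such continuation agrees with `F N` on a punctured
  -- neighbourhood of `s`.
  refine ⟨fun z => F (⌈abscissa b A - z.re⌉₊ + 1) z, fun s => ?_, fun s hs => ?_⟩
  · set N := ⌈abscissa b A - s.re⌉₊ + 2 with hNdef
    have hsN : abscissa b A - N < s.re := by
      have := Nat.le_ceil (abscissa b A - s.re)
      rw [hNdef]
      push_cast
      linarith
    refine (hF N s hsN).congr ?_
    have h1 : ∀ j ∈ Finset.range (N + 1), ∀ᶠ z in 𝓝[≠] s,
        abscissa b A - j < s.re → F N z = F j z := by
      intro j hj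
      by_cases hjs : abscissa b A - j < s.re
      · refine (eventuallyEq_of_eqOn_halfPlane (x := abscissa b A - j) (fun z hz => hF N z ?_)
          (fun z hz => hF j z hz) (fun z hz => (hF' N z hz).trans (hF' j z hz).symm) hjs).mono
          fun z hz _ => hz
        have : (j : ℝ) ≤ N := by exact_mod_cast Finset.mem_range_succ_iff.1 hj
        linarith
      · exact Eventually.of_forall fun z h => absurd h hjs
    have h2 : ∀ᶠ z : ℂ in 𝓝[≠] s, |z.re - s.re| < 1 := by
      refine Eventually.filter_mono nhdsWithin_le_nhds ?_
      exact (isOpen_lt (by fun_prop) continuous_const).mem_nhds (by simp)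
    filter_upwards [(Finset.eventually_all _).2 h1, h2] with z hz hz'
    rw [abs_lt] at hz'
    refine hz _ ?_ ?_
    · rw [Finset.mem_range, hNdef]
      have : ⌈abscissa b A - z.re⌉₊ ≤ ⌈abscissa b A - s.re⌉₊ + 1 := by
        rw [Nat.ceil_le]
        push_cast
        linarith [Nat.le_ceil (abscissa b A - s.re)]
      omega
    · push_cast
      linarith [Nat.le_ceil (abscissa b A - z.re)]
  · simp only [hF' _ s hs]
    exact (summable_term hb hA hN hs).hasSum

variable {K : ℂ → ℂ}

theorem IsMeromorphicContinuation.analyticAt (hK : IsMeromorphicContinuation b A K) (hb : 1 < b)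
    (hA : ∀ a ∈ A, a < b) (hN : 0 < A.card) {s : ℂ} (hs : abscissa b A < s.re) :
    AnalyticAt ℂ K s := by
  refine (analyticAt_tsum_term hb hA hN hs).congr ?_
  filter_upwards [(isOpen_lt continuous_const Complex.continuous_re).mem_nhds hs] with z hz
  exact (hK.2 z hz).tsum_eq

theorem IsMeromorphicContinuation.functional_equation (hK : IsMeromorphicContinuation b A K)
    (hb : 1 < b) (hA : ∀ a ∈ A, a < b) (hN : 0 < A.card) (n : ℕ) {s : ℂ}
    (hs : abscissa b A < s.re + (n + 1)) :
    (fun z => eulerFactor b A z * K z) =ᶠ[𝓝[≠] s] functionalRHS b A n K := by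
  refine eventuallyEq_of_eqOn_halfPlane (x := abscissa b A - (n + 1)) (y := abscissa b A)
    (fun z _ => ((differentiable_eulerFactor hb A).analyticAt z).meromorphicAt.mul (hK.1 z))
    (fun z hz => meromorphicAt_functionalRHS hb hA hN (by linarith) fun _ _ => hK.1 _)
    (fun z hz => ?_) (by linarith)
  rw [Pi.mul_apply, ← (hK.2 z hz).tsum_eq, eulerFactor_mul_tsum_term hb hA hN n hz]
  refine functionalRHS_congr fun j hj => (hK.2 _ ?_).tsum_eq
  have : (0 : ℝ) ≤ j := by positivity
  simp
  linarith

/-! ### Residues at the candidate poles. -/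

theorem candidatePole_re (m : ℕ) (k : ℤ) :
    (candidatePole b A m k).re = abscissa b A - m := by
  rw [candidatePole, Complex.add_re, Complex.sub_re, Complex.ofReal_re, Complex.natCast_re]
  have : (k : ℂ) * (2 * (Real.pi : ℂ) * Complex.I / (Real.log (b : ℝ) : ℂ)) =
      ((k * (2 * Real.pi / Real.log b) : ℝ) : ℂ) * Complex.I := by
    push_cast
    ring
  rw [this, Complex.re_ofReal_mul, Complex.I_re, mul_zero, add_zero]

theorem candidatePole_im (m : ℕ) (k : ℤ) :
    (candidatePole b A m k).im = k * (2 * Real.pi / Real.log b) := by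
  rw [candidatePole, Complex.add_im, Complex.sub_im, Complex.ofReal_im, Complex.natCast_im]
  have : (k : ℂ) * (2 * (Real.pi : ℂ) * Complex.I / (Real.log (b : ℝ) : ℂ)) =
      ((k * (2 * Real.pi / Real.log b) : ℝ) : ℂ) * Complex.I := by
    push_cast
    ring
  rw [this, Complex.im_ofReal_mul, Complex.I_im, mul_one, sub_zero, zero_add]

theorem candidatePole_add {m j : ℕ} (hj : j ≤ m) (k : ℤ) :
    candidatePole b A m k + j = candidatePole b A (m - j) k := by
  rw [candidatePole, candidatePole, Nat.cast_sub hj]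
  ring

theorem candidatePole_eq_sub (m : ℕ) (k : ℤ) :
    candidatePole b A m k = candidatePole b A 0 k - m := by
  rw [candidatePole, candidatePole]
  push_cast
  ring

theorem cpow_neg_candidatePole (hb : 1 < b) (hN : 0 < A.card) (m : ℕ) (k : ℤ) :
    (b : ℂ) ^ (-candidatePole b A m k) = (A.card : ℂ)⁻¹ * (b : ℂ) ^ m := by
  have hb0 : (b : ℂ) ≠ 0 := by exact_mod_cast (by omega : b ≠ 0)
  have hb1 : (1 : ℝ) < b := by exact_mod_cast hb
  have hlog : (Real.log b : ℂ) ≠ 0 := by exact_mod_cast (Real.log_pos hb1).ne'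
  have h1 : (b : ℂ) ^ (abscissa b A : ℂ) = A.card := by
    rw [← Complex.ofReal_natCast, ← Complex.ofReal_cpow (by linarith), rpow_abscissa hb hN,
      Complex.ofReal_natCast]
  have h2 : (b : ℂ) ^ ((k : ℂ) * (2 * (Real.pi : ℂ) * Complex.I / (Real.log (b : ℝ) : ℂ))) = 1 := by
    rw [Complex.cpow_def_of_ne_zero hb0, ← Complex.natCast_log]
    rw [mul_left_comm, mul_div_cancel₀ _ hlog]
    exact Complex.exp_int_mul_two_pi_mul_I k
  rw [Complex.cpow_neg, candidatePole, Complex.cpow_add _ _ hb0, Complex.cpow_sub _ _ hb0,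
    Complex.cpow_natCast, h1, h2, mul_one, inv_div, div_eq_inv_mul]

theorem eulerFactor_candidatePole (hb : 1 < b) (hN : 0 < A.card) (m : ℕ) (k : ℤ) :
    eulerFactor b A (candidatePole b A m k) = 1 - (b : ℂ) ^ m := by
  rw [eulerFactor, cpow_neg_candidatePole hb hN,
    mul_inv_cancel_left₀ (by exact_mod_cast hN.ne')]

theorem one_sub_pow_ne_zero (hb : 1 < b) {m : ℕ} (hm : m ≠ 0) : (1 : ℂ) - (b : ℂ) ^ m ≠ 0 := by
  rw [sub_ne_zero]
  exact_mod_cast (Nat.one_lt_pow hm hb).ne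

theorem deriv_eulerFactor_ne_zero (hb : 1 < b) (hN : 0 < A.card) (s : ℂ) :
    deriv (eulerFactor b A) s ≠ 0 := by
  have hb0 : (b : ℂ) ≠ 0 := by exact_mod_cast (by omega : b ≠ 0)
  have hb1 : (1 : ℝ) < b := by exact_mod_cast hb
  have hlog : Complex.log b ≠ 0 := by
    rw [← Complex.natCast_log]
    exact_mod_cast (Real.log_pos hb1).ne'
  have h : HasDerivAt (eulerFactor b A)
      (-((A.card : ℂ) * ((b : ℂ) ^ (-s) * Complex.log b * -1))) s :=
    ((((hasDerivAt_id s).neg).const_cpow (Or.inl hb0)).const_mul _).const_sub 1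
  rw [h.deriv, neg_ne_zero]
  refine mul_ne_zero (by exact_mod_cast hN.ne') (mul_ne_zero (mul_ne_zero ?_ hlog) (by norm_num))
  rw [Complex.cpow_def_of_ne_zero hb0]
  exact Complex.exp_ne_zero _

/-- Shifting by `j` moves `s_{m,k}` to `s_{m-j,k}`, while the digit sum and the remainder are
analytic at `s_{m,k}`; only the shifted copies of `K` contribute. -/
theorem hasSimpleResidue_functionalRHS (hb : 1 < b) (hA : ∀ a ∈ A, a < b) (hN : 0 < A.card)
    (m : ℕ) (k : ℤ) {c : ℕ → ℂ}
    (h : ∀ j ∈ Finset.Icc 1 m, HasSimpleResidue K (candidatePole b A (m - j) k) (c j)) :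
    HasSimpleResidue (functionalRHS b A m K) (candidatePole b A m k)
      ((A.card : ℂ)⁻¹ * (b : ℂ) ^ m * ∑ j ∈ Finset.Icc 1 m,
        binomCoeff (candidatePole b A m k) j * powerSum A j * ((b : ℂ) ^ j)⁻¹ * c j) := by
  set s := candidatePole b A m k with hs
  have h1 := HasSimpleResidue.of_analyticAt ((differentiable_digitSum A).analyticAt s)
  have h2 := (natCast_cpow_differentiable (by omega : b ≠ 0)).analyticAt s
  have h3 := HasSimpleResidue.of_analyticAt (analyticAt_remSeries hb hA hN (m + 1) (s₁ := s) (by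
    rw [hs, candidatePole_re]
    push_cast
    linarith))
  have h4 : ∀ j ∈ Finset.Icc 1 m, HasSimpleResidue
      (fun z => binomCoeff z j * powerSum A j * ((b : ℂ) ^ j)⁻¹ * K (z + j)) s
      (binomCoeff s j * powerSum A j * ((b : ℂ) ^ j)⁻¹ * c j) := by
    intro j hj
    have h5 := (differentiable_binomCoeff j).analyticAt s
    refine HasSimpleResidue.analyticAt_mul
      (u := fun z => binomCoeff z j * powerSum A j * ((b : ℂ) ^ j)⁻¹)
      ((h5.mul analyticAt_const).mul analyticAt_const) (HasSimpleResidue.comp_add _ ?_)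
    rw [hs, candidatePole_add (Finset.mem_Icc.1 hj).2]
    exact h j hj
  have h6 := h1.add (((HasSimpleResidue.sum _ h4).add h3).analyticAt_mul h2)
  rw [zero_add, add_zero, hs, cpow_neg_candidatePole hb hN] at h6
  exact h6

theorem functionalRHS_zero_analyticAt (hb : 1 < b) (hA : ∀ a ∈ A, a < b) (hN : 0 < A.card)
    (F : ℂ → ℂ) (k : ℤ) : AnalyticAt ℂ (functionalRHS b A 0 F) (candidatePole b A 0 k) := by
  have h1 := (differentiable_digitSum A).analyticAt (candidatePole b A 0 k)
  have h2 := (natCast_cpow_differentiable (by omega : b ≠ 0)).analyticAt (candidatePole b A 0 k)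
  have h3 := analyticAt_remSeries hb hA hN (0 + 1) (s₁ := candidatePole b A 0 k) (by
    rw [candidatePole_re]
    push_cast
    linarith)
  exact h1.fun_add (h2.fun_mul (AnalyticAt.fun_add (Finset.analyticAt_fun_sum _ (by simp)) h3))

theorem IsMeromorphicContinuation.hasSimpleResidue_zero (hK : IsMeromorphicContinuation b A K)
    (hb : 1 < b) (hA : ∀ a ∈ A, a < b) (hN : 0 < A.card) (k : ℤ) :
    HasSimpleResidue K (candidatePole b A 0 k)
      (functionalRHS b A 0 K (candidatePole b A 0 k) /
        deriv (eulerFactor b A) (candidatePole b A 0 k)) := by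
  refine HasSimpleResidue.of_mul_of_simple_zero ((differentiable_eulerFactor hb A).analyticAt _)
    ?_ (deriv_eulerFactor_ne_zero hb hN _) (functionalRHS_zero_analyticAt hb hA hN K k)
    (hK.functional_equation hb hA hN 0 ?_)
  · rw [eulerFactor_candidatePole hb hN, pow_zero, sub_self]
  · rw [candidatePole_re]
    simp

/-- Strong induction on `m`: beyond `m = 0` the Euler factor does not vanish, so at most simple
poles are inherited from the candidates to the right. -/
theorem IsMeromorphicContinuation.hasSimpleResidue (hK : IsMeromorphicContinuation b A K)
    (hb : 1 < b) (hA : ∀ a ∈ A, a < b) (hN : 0 < A.card) (m : ℕ) (k : ℤ) :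
    HasSimpleResidue K (candidatePole b A m k) (residue K (candidatePole b A m k)) := by
  suffices h : ∃ c, HasSimpleResidue K (candidatePole b A m k) c by
    obtain ⟨c, hc⟩ := h
    rwa [hc.residue_eq]
  induction m using Nat.strong_induction_on with
  | _ m ih =>
    rcases Nat.eq_zero_or_pos m with rfl | hm
    · exact ⟨_, hK.hasSimpleResidue_zero hb hA hN k⟩
    · have h1 := hasSimpleResidue_functionalRHS hb hA hN m k (K := K)
        (c := fun j => residue K (candidatePole b A (m - j) k)) (fun j hj => by
          obtain ⟨c, hc⟩ := ih (m - j) (by have := Finset.mem_Icc.1 hj; omega)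
          simpa only [hc.residue_eq] using hc)
      refine ⟨_, HasSimpleResidue.of_mul ((differentiable_eulerFactor hb A).analyticAt _) ?_
        (h1.congr (hK.functional_equation hb hA hN m ?_))⟩
      · rw [eulerFactor_candidatePole hb hN]
        exact one_sub_pow_ne_zero hb hm.ne'
      · rw [candidatePole_re]
        linarith

theorem IsMeromorphicContinuation.residue_recurrence (hK : IsMeromorphicContinuation b A K)
    (hb : 1 < b) (hA : ∀ a ∈ A, a < b) (hN : 0 < A.card) (m : ℕ) (k : ℤ) :
    (1 - (b : ℂ) ^ m) * residue K (candidatePole b A m k) =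
      (A.card : ℂ)⁻¹ * (b : ℂ) ^ m * ∑ j ∈ Finset.Icc 1 m,
        binomCoeff (candidatePole b A m k) j * powerSum A j * ((b : ℂ) ^ j)⁻¹ *
          residue K (candidatePole b A (m - j) k) := by
  have h1 := hasSimpleResidue_functionalRHS hb hA hN m k (K := K)
    (c := fun j => residue K (candidatePole b A (m - j) k)) fun j _ =>
      hK.hasSimpleResidue hb hA hN (m - j) k
  have h2 := h1.congr (hK.functional_equation hb hA hN m (by
    rw [candidatePole_re]
    linarith))
  have h3 := (hK.hasSimpleResidue hb hA hN m k).analyticAt_mul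
    ((differentiable_eulerFactor hb A).analyticAt _)
  rw [← h2.residue_eq, h3.residue_eq, eulerFactor_candidatePole hb hN]

/-- With no binomial terms kept, the right-hand side does not involve `K` and is analytic at `s₀`.
The lower bound `b ^ (-σ)` therefore passes to the limit `σ → s₀` from the right and keeps the value
at `s₀` nonzero. -/
theorem IsMeromorphicContinuation.residue_zero_zero_ne_zero
    (hK : IsMeromorphicContinuation b A K) (hb : 1 < b) (hA : ∀ a ∈ A, a < b)
    (hA1 : ∃ a ∈ A, a ≠ 0) : residue K (candidatePole b A 0 0) ≠ 0 := by
  have hN : 0 < A.card := Finset.card_pos.2 (hA1.imp fun _ h => h.1)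
  have hb0 : (0 : ℝ) < b := by exact_mod_cast (by omega : 0 < b)
  rw [(hK.hasSimpleResidue_zero hb hA hN 0).residue_eq]
  refine div_ne_zero ?_ (deriv_eulerFactor_ne_zero hb hN _)
  have hs : candidatePole b A 0 0 = (abscissa b A : ℂ) := by simp [candidatePole]
  have hc := (functionalRHS_zero_analyticAt hb hA hN K 0).continuousAt
  rw [hs] at hc ⊢
  have h1 : Tendsto (fun σ : ℝ => (functionalRHS b A 0 K σ).re) (𝓝[>] (abscissa b A))
      (𝓝 (functionalRHS b A 0 K (abscissa b A)).re) :=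
    ((Complex.continuous_re.tendsto _).comp (hc.tendsto.comp
      (Complex.continuous_ofReal.tendsto (abscissa b A)))).mono_left nhdsWithin_le_nhds
  have h2 : Tendsto (fun σ : ℝ => (b : ℝ) ^ (-σ)) (𝓝[>] (abscissa b A))
      (𝓝 ((b : ℝ) ^ (-abscissa b A))) :=
    ((Real.continuous_const_rpow hb0.ne').comp continuous_neg).tendsto _ |>.mono_left
      nhdsWithin_le_nhds
  have h3 := le_of_tendsto_of_tendsto h2 h1 ?_
  · intro h0
    rw [h0, Complex.zero_re] at h3
    exact absurd h3 (not_le.2 (Real.rpow_pos_of_pos hb0 _))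
  · filter_upwards [self_mem_nhdsWithin] with σ hσ
    have hσ' : abscissa b A < (σ : ℂ).re := hσ
    have h4 := eulerFactor_mul_tsum_term hb hA hN 0 hσ'
    have h5 : functionalRHS b A 0 (fun s => ∑' m, term b A s m) σ = functionalRHS b A 0 K σ :=
      functionalRHS_congr (by simp)
    have h6 : ∑' m, term b A σ m = ((∑' n, Set.indicator {n | Admissible b A n}
        (fun n : ℕ => (n : ℝ) ^ (-σ)) n : ℝ) : ℂ) := by
      rw [Complex.ofReal_tsum]
      refine tsum_congr fun n => ?_
      rw [term]
      by_cases hn : Admissible b A n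
      · rw [Set.indicator_of_mem (by exact hn), Set.indicator_of_mem (by exact hn),
          Complex.ofReal_cpow (by positivity)]
        push_cast
        rfl
      · rw [Set.indicator_of_notMem (by exact hn), Set.indicator_of_notMem (by exact hn),
          Complex.ofReal_zero]
    have h7 : eulerFactor b A σ = ((1 - (A.card : ℝ) * (b : ℝ) ^ (-σ) : ℝ) : ℂ) := by
      rw [eulerFactor]
      push_cast
      rw [Complex.ofReal_cpow hb0.le]
      push_cast
      rfl
    rw [← h5, ← h4, h6, h7, ← Complex.ofReal_mul, Complex.ofReal_re]
    exact rpow_le_mul_tsum hb hA hA1 hσ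

end

/-! ### The recurrence and the Pochhammer normalization. -/

/-- The linear recurrence satisfied by the modified residues. -/
def SatisfiesRecurrence (b : ℕ) (A : Finset ℕ) (v : ℕ → ℂ) : Prop :=
  ∀ m : ℕ, (1 - ((b : ℂ) ^ m)⁻¹) * v m = -((A.card : ℂ)⁻¹) * ∑ j ∈ Finset.Icc 1 m,
    (m.choose j : ℂ) * ((b : ℂ) ^ j)⁻¹ * powerSum A j * v (m - j)

/-- The ratio between a residue and the corresponding modified residue. -/
noncomputable def residueFactor (σ : ℂ) (m : ℕ) : ℂ :=
  -((ascPochhammer ℂ (m + 1)).eval (-σ)) / (m.factorial : ℂ)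

/-- Absorbing the signs turns `(σ - m)_j` into the `j` largest-index factors `m - σ, …, m - j + 1 -
σ` of `(-σ)_{m+1}`. -/
theorem ascPochhammer_eval_sub_mul (σ : ℂ) {j m : ℕ} (hj : j ≤ m) :
    (-1) ^ j * (ascPochhammer ℂ j).eval (σ - m) * (ascPochhammer ℂ (m - j + 1)).eval (-σ) =
      (ascPochhammer ℂ (m + 1)).eval (-σ) := by
  induction j with
  | zero => simp
  | succ j ih =>
    obtain ⟨i, rfl⟩ := Nat.exists_eq_add_of_le hj
    rw [← ih (by omega), show j + 1 + i - j + 1 = (i + 1) + 1 by omega,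
      show j + 1 + i - (j + 1) + 1 = i + 1 by omega, ascPochhammer_succ_eval (i + 1),
      ascPochhammer_succ_eval j]
    push_cast
    ring

theorem binomCoeff_mul_residueFactor (σ : ℂ) {j m : ℕ} (hj : j ≤ m) :
    binomCoeff (σ - m) j * residueFactor σ (m - j) = residueFactor σ m * m.choose j := by
  rw [binomCoeff, residueFactor, residueFactor, ← ascPochhammer_eval_sub_mul σ hj,
    Nat.cast_choose ℂ hj]
  have h1 : (m.factorial : ℂ) ≠ 0 := by exact_mod_cast m.factorial_ne_zero
  have h2 : (j.factorial : ℂ) ≠ 0 := by exact_mod_cast j.factorial_ne_zero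
  have h3 : ((m - j).factorial : ℂ) ≠ 0 := by exact_mod_cast (m - j).factorial_ne_zero
  field_simp

/-- For `N = 1` the real candidate poles are `-m`, so the residue recurrence has binomial
coefficients without any normalization. -/
theorem binomCoeff_neg_natCast {j m : ℕ} : binomCoeff (-m) j = m.choose j := by
  rw [binomCoeff, ascPochhammer_eval_neg_eq_descPochhammer, descPochhammer_eval_eq_descFactorial,
    ← mul_assoc, ← mul_pow, neg_one_mul, neg_neg, one_pow, one_mul,
    div_eq_iff (by exact_mod_cast j.factorial_ne_zero), mul_comm]
  exact_mod_cast Nat.descFactorial_eq_factorial_mul_choose m j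

section

variable {b : ℕ} {A : Finset ℕ} {K : ℂ → ℂ} {v w : ℕ → ℂ}

theorem one_sub_inv_pow_ne_zero (hb : 1 < b) {m : ℕ} (hm : m ≠ 0) :
    (1 : ℂ) - ((b : ℂ) ^ m)⁻¹ ≠ 0 := by
  rw [sub_ne_zero, ne_comm, inv_ne_one]
  exact_mod_cast (Nat.one_lt_pow hm hb).ne'

theorem satisfiesRecurrence_of_mul_pow (hb : 1 < b)
    (h : ∀ m : ℕ, (1 - (b : ℂ) ^ m) * v m = (A.card : ℂ)⁻¹ * (b : ℂ) ^ m *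
      ∑ j ∈ Finset.Icc 1 m, (m.choose j : ℂ) * ((b : ℂ) ^ j)⁻¹ * powerSum A j * v (m - j)) :
    SatisfiesRecurrence b A v := by
  intro m
  have hbm : (b : ℂ) ^ m ≠ 0 := pow_ne_zero _ (by exact_mod_cast (by omega : b ≠ 0))
  have h1 := h m
  rw [← mul_right_inj' hbm, ← mul_assoc, mul_sub, mul_one, mul_inv_cancel₀ hbm]
  linear_combination -h1

/-- For `m ≥ 1` the factor `1 - b ^ (-m)` is nonzero, so the initial value determines a solution;
cross-multiplication spares any assumption on `w 0`. -/
theorem SatisfiesRecurrence.mul_eq_mul (hb : 1 < b) (hv : SatisfiesRecurrence b A v)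
    (hw : SatisfiesRecurrence b A w) (m : ℕ) : v m * w 0 = v 0 * w m := by
  induction m using Nat.strong_induction_on with
  | _ m ih =>
    rcases Nat.eq_zero_or_pos m with rfl | hm
    · rfl
    · refine mul_left_cancel₀ (one_sub_inv_pow_ne_zero hb hm.ne') ?_
      rw [← mul_assoc, hv m, mul_left_comm, hw m, mul_left_comm, mul_assoc, Finset.sum_mul,
        Finset.mul_sum _ _ (v 0)]
      refine congrArg (-((A.card : ℂ)⁻¹) * ·) (Finset.sum_congr rfl fun j hj => ?_)
      have := ih (m - j) (by have := Finset.mem_Icc.1 hj; omega)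
      linear_combination (m.choose j : ℂ) * ((b : ℂ) ^ j)⁻¹ * powerSum A j * this

theorem satisfiesRecurrence_normalizedSolution (hb : 1 < b) :
    SatisfiesRecurrence b A (normalizedSolution b A) := by
  intro m
  rcases m with _ | m
  · simp
  · rw [normalizedSolution, mul_div_cancel₀ _ (one_sub_inv_pow_ne_zero hb m.succ_ne_zero)]
    congr 1
    rw [Finset.sum_fin_eq_sum_range, ← Finset.sum_range_reflect]
    refine Finset.sum_nbij' (fun i => i + 1) (fun i => i - 1) ?_ ?_ ?_ ?_ ?_
    · intro i hi
      simp only [Finset.mem_range, Finset.mem_Icc] at hi ⊢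
      omega
    · intro i hi
      simp only [Finset.mem_range, Finset.mem_Icc] at hi ⊢
      omega
    · intro i hi
      simp
    · intro i hi
      rw [Finset.mem_Icc] at hi
      omega
    · intro i hi
      rw [Finset.mem_range] at hi
      rw [dif_pos (by omega)]
      simp only [show m + 1 - 1 - i = m + 1 - (i + 1) by omega,
        Nat.sub_sub_self (Nat.succ_le_of_lt hi), Nat.succ_eq_add_one]

theorem satisfiesRecurrence_pow (hb : 1 < b) {f : ℕ} (hA : A = {f}) :
    SatisfiesRecurrence b A fun m => (-(f : ℂ) / ((b : ℂ) - 1)) ^ m := by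
  subst hA
  intro m
  have hb0 : (b : ℂ) ≠ 0 := by exact_mod_cast (by omega : b ≠ 0)
  have hb1 : (b : ℂ) - 1 ≠ 0 := by
    rw [sub_ne_zero]
    exact_mod_cast hb.ne'
  -- With `x = -f / (b - 1)` one has `f / b + x = x / b`; the binomial expansion of the `m`-th
  -- power, with its `j = 0` term isolated, is the recurrence.
  have h1 := add_pow ((f : ℂ) / b) (-(f : ℂ) / ((b : ℂ) - 1)) m
  have h2 : (f : ℂ) / b + -(f : ℂ) / ((b : ℂ) - 1) = (-(f : ℂ) / ((b : ℂ) - 1)) * (b : ℂ)⁻¹ := by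
    field_simp
    ring
  have hI : Finset.Ico (0 + 1) (m + 1) = Finset.Icc 1 m := by
    ext
    simp only [Finset.mem_Ico, Finset.mem_Icc]
    omega
  rw [h2, mul_pow, inv_pow, Finset.range_eq_Ico, Finset.sum_eq_sum_Ico_succ_bot m.succ_pos, hI] at h1
  have h3 : ∑ j ∈ Finset.Icc 1 m, (m.choose j : ℂ) * ((b : ℂ) ^ j)⁻¹ * powerSum {f} j *
      (-(f : ℂ) / ((b : ℂ) - 1)) ^ (m - j) = ∑ j ∈ Finset.Icc 1 m,
      ((f : ℂ) / b) ^ j * (-(f : ℂ) / ((b : ℂ) - 1)) ^ (m - j) * (m.choose j : ℂ) := by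
    refine Finset.sum_congr rfl fun j _ => ?_
    rw [powerSum, Finset.sum_singleton, div_pow, div_eq_mul_inv]
    ring
  rw [h3, Finset.card_singleton]
  simp only [pow_zero, one_mul, Nat.sub_zero, Nat.choose_zero_right, Nat.cast_one, mul_one] at h1
  push_cast
  linear_combination -h1

/-! ### Modified residues, and the exceptional cases `N = 1` and `N = b`. -/

/-- A zero of the Pochhammer symbol makes `s_{0,k}` a natural number `i`. The imaginary part then
gives `k = 0`, the real part `N = b ^ i`, and `N ≤ b` leaves only `i = 0` or `i = 1`. -/
theorem residueFactor_ne_zero (hb : 1 < b) (hA : ∀ a ∈ A, a < b) (hN : 0 < A.card) {k : ℤ}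
    (h1 : ¬ (k = 0 ∧ A.card = 1)) (h2 : ¬ (k = 0 ∧ A.card = b)) (m : ℕ) :
    residueFactor (candidatePole b A 0 k) m ≠ 0 := by
  have hb1 : (1 : ℝ) < b := by exact_mod_cast hb
  refine div_ne_zero (neg_ne_zero.2 ?_) (by exact_mod_cast m.factorial_ne_zero)
  rw [Ne, ascPochhammer_eval_eq_zero_iff]
  rintro ⟨i, -, hi⟩
  rw [neg_neg] at hi
  have hre := congrArg Complex.re hi
  have him := congrArg Complex.im hi
  rw [candidatePole_re, Complex.natCast_re, Nat.cast_zero, sub_zero] at hre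
  rw [candidatePole_im, Complex.natCast_im, eq_comm, mul_eq_zero_iff_right (by
    have := Real.pi_pos
    have := Real.log_pos hb1
    positivity)] at him
  have hk : k = 0 := by exact_mod_cast him
  have hcard : A.card = b ^ i := by
    have := rpow_abscissa hb hN
    rw [← hre, Real.rpow_natCast] at this
    exact_mod_cast this.symm
  have hle : A.card ≤ b := by
    have : A ⊆ Finset.range b := fun a ha => Finset.mem_range.2 (hA a ha)
    simpa using Finset.card_le_card this
  rcases i with _ | _ | i
  · exact h1 ⟨hk, by simpa using hcard⟩
  · exact h2 ⟨hk, by simpa using hcard⟩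
  · have : b ^ 1 < b ^ (i + 1 + 1) := Nat.pow_lt_pow_right hb (by omega)
    rw [pow_one] at this
    omega

theorem modifiedResidue_eq_div {k : ℤ} (h1 : ¬ (k = 0 ∧ A.card = 1))
    (h2 : ¬ (k = 0 ∧ A.card = b)) (m : ℕ) :
    modifiedResidue b A K m k =
      residue K (candidatePole b A m k) / residueFactor (candidatePole b A 0 k) m := by
  rw [modifiedResidue, if_neg h1, if_neg h2, residueFactor]

theorem modifiedResidue_of_card_eq_one (h : A.card = 1) :
    ∃ f, A = {f} ∧ ∀ m, modifiedResidue b A K m 0 = (-(f : ℂ) / ((b : ℂ) - 1)) ^ m := by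
  obtain ⟨f, rfl⟩ := Finset.card_eq_one.1 h
  refine ⟨f, rfl, fun m => ?_⟩
  rw [modifiedResidue, if_pos ⟨rfl, h⟩, Finset.sum_singleton]

theorem modifiedResidue_of_card_eq (hb : 1 < b) (h : A.card = b) (m : ℕ) :
    modifiedResidue b A K m 0 = normalizedSolution b A m := by
  rw [modifiedResidue, if_neg (by omega), if_pos ⟨rfl, h⟩]

theorem IsMeromorphicContinuation.satisfiesRecurrence_modifiedResidue
    (hK : IsMeromorphicContinuation b A K) (hb : 1 < b) (hA : ∀ a ∈ A, a < b)
    (hN : 0 < A.card) (k : ℤ) :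
    SatisfiesRecurrence b A fun m => modifiedResidue b A K m k := by
  by_cases h1 : k = 0 ∧ A.card = 1
  · obtain ⟨rfl, h1⟩ := h1
    obtain ⟨f, hf, h⟩ := modifiedResidue_of_card_eq_one (b := b) (K := K) h1
    simp only [h]
    exact satisfiesRecurrence_pow hb hf
  by_cases h2 : k = 0 ∧ A.card = b
  · obtain ⟨rfl, h2⟩ := h2
    simp only [modifiedResidue_of_card_eq hb h2]
    exact satisfiesRecurrence_normalizedSolution hb
  have hne := residueFactor_ne_zero hb hA hN h1 h2
  have hres : ∀ m, residue K (candidatePole b A m k) =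
      residueFactor (candidatePole b A 0 k) m * modifiedResidue b A K m k := fun m => by
    rw [modifiedResidue_eq_div h1 h2, mul_div_cancel₀ _ (hne m)]
  refine satisfiesRecurrence_of_mul_pow hb fun m => mul_left_cancel₀ (hne m) ?_
  have h3 := hK.residue_recurrence hb hA hN m k
  rw [hres m] at h3
  rw [mul_left_comm, h3, mul_left_comm, Finset.mul_sum _ _ (residueFactor _ m)]
  congr 1
  refine Finset.sum_congr rfl fun j hj => ?_
  have h4 := binomCoeff_mul_residueFactor (candidatePole b A 0 k) (Finset.mem_Icc.1 hj).2
  rw [hres (m - j), candidatePole_eq_sub m k]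
  linear_combination powerSum A j * ((b : ℂ) ^ j)⁻¹ * modifiedResidue b A K (m - j) k * h4

theorem IsMeromorphicContinuation.modifiedResidue_zero_zero_ne_zero
    (hK : IsMeromorphicContinuation b A K) (hb : 1 < b) (hA : ∀ a ∈ A, a < b)
    (hA1 : ∃ a ∈ A, a ≠ 0) : modifiedResidue b A K 0 0 ≠ 0 := by
  have hN : 0 < A.card := Finset.card_pos.2 (hA1.imp fun _ h => h.1)
  by_cases h1 : A.card = 1
  · obtain ⟨f, -, h⟩ := modifiedResidue_of_card_eq_one (b := b) (K := K) h1
    rw [h, pow_zero]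
    exact one_ne_zero
  by_cases h2 : A.card = b
  · rw [modifiedResidue_of_card_eq hb h2, normalizedSolution]
    exact one_ne_zero
  rw [modifiedResidue_eq_div (fun h => h1 h.2) (fun h => h2 h.2)]
  exact div_ne_zero (hK.residue_zero_zero_ne_zero hb hA hA1)
    (residueFactor_ne_zero hb hA hN (fun h => h1 h.2) (fun h => h2 h.2) 0)

theorem IsMeromorphicContinuation.modifiedResidue_eq (hK : IsMeromorphicContinuation b A K)
    (hb : 1 < b) (hA : ∀ a ∈ A, a < b) (hA1 : ∃ a ∈ A, a ≠ 0) (m : ℕ) (k : ℤ) :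
    modifiedResidue b A K m k =
      modifiedResidue b A K 0 k / modifiedResidue b A K 0 0 * modifiedResidue b A K m 0 := by
  have hN : 0 < A.card := Finset.card_pos.2 (hA1.imp fun _ h => h.1)
  rw [div_mul_eq_mul_div, eq_div_iff (hK.modifiedResidue_zero_zero_ne_zero hb hA hA1)]
  exact (hK.satisfiesRecurrence_modifiedResidue hb hA hN k).mul_eq_mul hb
    (hK.satisfiesRecurrence_modifiedResidue hb hA hN 0) m

theorem IsMeromorphicContinuation.isPole_iff (hK : IsMeromorphicContinuation b A K)
    (hb : 1 < b) (hA : ∀ a ∈ A, a < b) (hN : 0 < A.card) (m : ℕ) (k : ℤ) :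
    IsPole K (candidatePole b A m k) ↔ residue K (candidatePole b A m k) ≠ 0 :=
  (hK.hasSimpleResidue hb hA hN m k).isPole_iff

theorem IsMeromorphicContinuation.isPole_iff_modifiedResidue
    (hK : IsMeromorphicContinuation b A K) (hb : 1 < b) (hA : ∀ a ∈ A, a < b)
    (hN : 0 < A.card) {k : ℤ} (h1 : ¬ (k = 0 ∧ A.card = 1)) (h2 : ¬ (k = 0 ∧ A.card = b))
    (m : ℕ) : IsPole K (candidatePole b A m k) ↔ modifiedResidue b A K m k ≠ 0 := by
  rw [hK.isPole_iff hb hA hN, modifiedResidue_eq_div h1 h2, Ne, Ne,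
    div_eq_zero_iff, or_iff_left (residueFactor_ne_zero hb hA hN h1 h2 m)]

/-- With a single admissible digit, the residues at the real candidate poles are proportional to
the modified residues. -/
theorem IsMeromorphicContinuation.residue_of_card_eq_one (hK : IsMeromorphicContinuation b A K)
    (hb : 1 < b) (hA : ∀ a ∈ A, a < b) (h1 : A.card = 1) (m : ℕ) :
    residue K (candidatePole b A m 0) =
      residue K (candidatePole b A 0 0) * modifiedResidue b A K m 0 := by
  have hN : 0 < A.card := by omega
  have hpole : ∀ m, candidatePole b A m 0 = -(m : ℂ) := fun m => by
    simp [candidatePole, abscissa, h1]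
  have hrec : SatisfiesRecurrence b A fun m => residue K (candidatePole b A m 0) := by
    refine satisfiesRecurrence_of_mul_pow hb fun m => ?_
    rw [hK.residue_recurrence hb hA hN m 0]
    congr 1
    refine Finset.sum_congr rfl fun j _ => ?_
    rw [hpole m, binomCoeff_neg_natCast]
    ring
  have := hrec.mul_eq_mul hb (hK.satisfiesRecurrence_modifiedResidue hb hA hN 0) m
  obtain ⟨f, -, h⟩ := modifiedResidue_of_card_eq_one (b := b) (K := K) h1
  simp only [h 0, pow_zero, mul_one] at this
  exact this

/-- If all digits are admissible, then `K` is the Riemann zeta function, which is analytic at the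
nonreal points of the line `Re s = 1`. -/
theorem IsMeromorphicContinuation.residue_of_card_eq (hK : IsMeromorphicContinuation b A K)
    (hb : 1 < b) (hA : ∀ a ∈ A, a < b) (h : A.card = b) {k : ℤ} (hk : k ≠ 0) :
    residue K (candidatePole b A 0 k) = 0 := by
  have hb1 : (1 : ℝ) < b := by exact_mod_cast hb
  have hAr : A = Finset.range b :=
    Finset.eq_of_subset_of_card_le (fun a ha => Finset.mem_range.2 (hA a ha)) (by simp [h])
  have habs : abscissa b A = 1 := by
    rw [abscissa, h, Real.logb_self_eq_one hb1]
  have hadm : ∀ n, Admissible b A n ↔ n ≠ 0 := by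
    intro n
    rw [Admissible, Nat.pos_iff_ne_zero, and_iff_left]
    intro d hd
    rw [hAr, Finset.mem_range]
    exact Nat.digits_lt_base hb hd
  have hne : candidatePole b A 0 k ≠ 1 := by
    intro h0
    have := congrArg Complex.im h0
    rw [candidatePole_im, Complex.one_im] at this
    have h3 := Real.pi_pos
    have h4 := Real.log_pos hb1
    have h5 : (k : ℝ) ≠ 0 := by exact_mod_cast hk
    exact mul_ne_zero h5 (by positivity) this
  have hζ : ∀ z : ℂ, z ≠ 1 → AnalyticAt ℂ riemannZeta z := fun z hz => by
    have hd : DifferentiableOn ℂ riemannZeta {1}ᶜ := fun w hw =>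
      (differentiableAt_riemannZeta hw).differentiableWithinAt
    exact hd.analyticAt (isOpen_compl_singleton.mem_nhds hz)
  have hKζ : ∀ z : ℂ, 1 < z.re → K z = riemannZeta z := by
    intro z hz
    rw [← (hK.2 z (by rwa [habs])).tsum_eq, zeta_eq_tsum_one_div_nat_cpow hz]
    refine tsum_congr fun n => ?_
    rw [term]
    by_cases hn : n = 0
    · rw [Set.indicator_of_notMem (by simp [hadm, hn]), hn, Nat.cast_zero,
        Complex.zero_cpow (by rintro rfl; norm_num at hz), div_zero]
    · rw [Set.indicator_of_mem (by simpa [hadm] using hn), Complex.cpow_neg, one_div]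
  -- Equality with zeta is known only to the right of the line `Re s = 1`. Approaching the candidate
  -- horizontally from there gives frequent equality, which for meromorphic functions implies
  -- equality on a punctured neighbourhood.
  have ht : Tendsto (fun t : ℝ => candidatePole b A 0 k + t) (𝓝[>] 0)
      (𝓝[≠] candidatePole b A 0 k) := by
    refine tendsto_nhdsWithin_iff.2 ⟨?_, ?_⟩
    · have hc : Continuous fun t : ℝ => candidatePole b A 0 k + t := by fun_prop
      simpa using (hc.tendsto 0).mono_left nhdsWithin_le_nhds
    · filter_upwards [self_mem_nhdsWithin] with t ht
      simpa using (ne_of_gt ht : t ≠ 0)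
  have hev : ∀ᶠ t : ℝ in 𝓝[>] 0,
      K (candidatePole b A 0 k + t) = riemannZeta (candidatePole b A 0 k + t) := by
    filter_upwards [self_mem_nhdsWithin] with t ht
    refine hKζ _ ?_
    rw [Complex.add_re, candidatePole_re, habs, Complex.ofReal_re, Nat.cast_zero, sub_zero]
    exact lt_add_of_pos_right 1 ht
  refine ((HasSimpleResidue.of_analyticAt (hζ _ hne)).congr ?_).residue_eq
  exact ((hK.1 _).frequently_eq_iff_eventuallyEq (hζ _ hne).meromorphicAt).1
    (ht.frequently hev.frequently)

/-! ### The criterion for poles. -/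

theorem IsMeromorphicContinuation.isPole_iff_and (hK : IsMeromorphicContinuation b A K)
    (hb : 1 < b) (hA : ∀ a ∈ A, a < b) (hA1 : ∃ a ∈ A, a ≠ 0) (m : ℕ) (k : ℤ) :
    IsPole K (candidatePole b A m k) ↔
      IsPole K (candidatePole b A m 0) ∧ IsPole K (candidatePole b A 0 k) := by
  have hN : 0 < A.card := Finset.card_pos.2 (hA1.imp fun _ h => h.1)
  have h00 := (hK.isPole_iff hb hA hN 0 0).2 (hK.residue_zero_zero_ne_zero hb hA hA1)
  have hμ := hK.modifiedResidue_zero_zero_ne_zero hb hA hA1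
  by_cases hk : k = 0
  · rw [hk, and_iff_left h00]
  have hk1 : ¬ (k = 0 ∧ A.card = 1) := fun h => hk h.1
  have hk2 : ¬ (k = 0 ∧ A.card = b) := fun h => hk h.1
  have hpole := hK.isPole_iff_modifiedResidue hb hA hN hk1 hk2
  have hm := hK.modifiedResidue_eq hb hA hA1 m k
  -- When `N = b`, `modifiedResidue b A K m 0` is not tied to the residue of `K`; but here `k ≠ 0`,
  -- and the absence of a pole at `s_{0,k}` makes both sides false.
  by_cases h2 : A.card = b
  · have h3 : ¬ IsPole K (candidatePole b A 0 k) := by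
      rw [hK.isPole_iff hb hA hN, not_not]
      exact hK.residue_of_card_eq hb hA h2 hk
    have h4 := h3
    rw [hpole, not_not] at h4
    refine iff_of_false ?_ fun h => h3 h.2
    rw [hpole, hm, h4, zero_div, zero_mul, not_not]
  have hreal : IsPole K (candidatePole b A m 0) ↔ modifiedResidue b A K m 0 ≠ 0 := by
    by_cases h1 : A.card = 1
    · rw [hK.isPole_iff hb hA hN, hK.residue_of_card_eq_one hb hA h1, mul_ne_zero_iff,
        and_iff_right (hK.residue_zero_zero_ne_zero hb hA hA1)]
    · exact hK.isPole_iff_modifiedResidue hb hA hN (fun h => h1 h.2) (fun h => h2 h.2) m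
  rw [hpole, hpole, hreal, hm, mul_ne_zero_iff, div_ne_zero_iff, and_iff_left hμ, and_comm]

end

end RestrictedDirichlet

theorem mainTheorem8 (b : ℕ) (hb : 1 < b) (A : Finset ℕ) (hA : ∀ a ∈ A, a < b)
    (hA1 : ∃ a ∈ A, a ≠ 0) :
    (∃ K : ℂ → ℂ, RestrictedDirichlet.IsMeromorphicContinuation b A K) ∧
    ∀ K : ℂ → ℂ, RestrictedDirichlet.IsMeromorphicContinuation b A K →
      (∀ (m : ℕ) (k : ℤ),
        (1 - ((b : ℂ) ^ m)⁻¹) * RestrictedDirichlet.modifiedResidue b A K m k =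
          -((A.card : ℂ)⁻¹) * ∑ j ∈ Finset.Icc 1 m,
            (m.choose j : ℂ) * ((b : ℂ) ^ j)⁻¹ * RestrictedDirichlet.powerSum A j *
              RestrictedDirichlet.modifiedResidue b A K (m - j) k) ∧
      RestrictedDirichlet.modifiedResidue b A K 0 0 ≠ 0 ∧
      (∀ (m : ℕ) (k : ℤ),
        RestrictedDirichlet.modifiedResidue b A K m k =
          RestrictedDirichlet.modifiedResidue b A K 0 k /
            RestrictedDirichlet.modifiedResidue b A K 0 0 *
              RestrictedDirichlet.modifiedResidue b A K m 0) ∧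
      (∀ (m : ℕ) (k : ℤ),
        RestrictedDirichlet.IsPole K (RestrictedDirichlet.candidatePole b A m k) ↔
          RestrictedDirichlet.IsPole K (RestrictedDirichlet.candidatePole b A m 0) ∧
          RestrictedDirichlet.IsPole K (RestrictedDirichlet.candidatePole b A 0 k)) := by
  have hN : 0 < A.card := Finset.card_pos.2 (hA1.imp fun _ h => h.1)
  refine ⟨RestrictedDirichlet.exists_isMeromorphicContinuation hb hA hN, fun K hK => ⟨?_, ?_, ?_, ?_⟩⟩
  · exact fun m k => hK.satisfiesRecurrence_modifiedResidue hb hA hN k m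
  · exact hK.modifiedResidue_zero_zero_ne_zero hb hA hA1
  · exact hK.modifiedResidue_eq hb hA hA1
  · exact hK.isPole_iff_and hb hA hA1
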